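/- Let $M$ be a compact connected complex manifold of complex dimension $n\ge 2$, with complex structure $I$, and let $(\omega,\theta)$ be a locally conformally Kähler (LCK) structure on $M$: $\omega=g(\cdot,I\cdot)$ is the fundamental form of a smooth Hermitian metric $g$, and $\theta$ is a smooth real $1$-form (the Lee form) with $d\omega=\theta\wedge\omega$ and $d\theta=0$. For a real $1$-form $\alpha$ put $\alpha^c:=\alpha\circ I$ and $d^c\alpha:=d(\alpha^c)$, and for a real function $f$ put $d^cf:=df\circ I$. Assume that $(M,\omega,\theta)$ is an LCK manifold with potential, that is, there are a connected Kähler covering $\pi:\tilde M\to M$ (a holomorphic covering) and a smooth function $\psi:\tilde M\to(0,\infty)$ such that $dd^c\psi$ is the Kähler form of $\tilde M$, every deck transformation $\gamma$ of $\pi$ is a holomorphic homothety of the Kähler metric with $\psi\circ\gamma=c_\gamma\psi$ for a constant $c_\gamma>0$, the scale factor of $\gamma$, and $$\pi^*\omega=\psi^{-1}\,dd^c\psi,\qquad \pi^*\theta=-d\log\psi .$$ Then the LCK metric $g$ is Gauduchon, i.e. $\partial\bar\partial\,\omega^{n-1}=0$, if and only if the $2$-form $\omega_0:=-d^c\theta$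 is a semi-positive definite $(1,1)$-form, i.e. $\omega_0(Iv,Iw)=\omega_0(v,w)$ and $\omega_0(Iv,v)\ge 0$ for all tangent vectors $v,w$ of $M$ at the same point. (With this sign convention $\omega$ itself is positive: $\omega(Iv,v)=g(v,v)$.) -/

import Mathlib

open scoped Manifold ContDiff Topology TensorProduct

/-! ## Exterior product of alternating forms -/

section Wedge

variable {V : Type*} [AddCommGroup V] [Module ℝ V] [TopologicalSpace V]

/-- Exterior product of a real `k`-form and a real `l`-form on `V`: the sum over `(k, l)`-shuffles
`σ` of `sign σ • α (v ∘ σ on the first k) * β (v ∘ σ on the last l)`. With this normalization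
`(α ∧ β) (x, y) = α x * β y - α y * β x` for one-forms. -/
noncomputable def wedge {k l : ℕ} (α : V [⋀^Fin k]→L[ℝ] ℝ) (β : V [⋀^Fin l]→L[ℝ] ℝ) :
    V [⋀^Fin (k + l)]→L[ℝ] ℝ :=
  { ((LinearMap.mul' ℝ ℝ).compAlternatingMap
      (α.toAlternatingMap.domCoprod β.toAlternatingMap)).domDomCongr finSumFinEquiv with
    cont := by
      change Continuous fun v : Fin (k + l) → V => LinearMap.mul' ℝ ℝ
        ((α.toAlternatingMap.domCoprod β.toAlternatingMap) (fun i => v (finSumFinEquiv i)))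
      simp only [AlternatingMap.domCoprod_apply, sum_apply, map_sum]
      refine continuous_finsetSum _ fun σ _ => ?_
      induction σ using Quotient.inductionOn' with
      | h σ =>
        change Continuous fun v : Fin (k + l) → V => LinearMap.mul' ℝ ℝ
          ((Equiv.Perm.sign σ : ℤ) •
            ((α fun i => v (finSumFinEquiv (σ (Sum.inl i)))) ⊗ₜ[ℝ]
              (β fun i => v (finSumFinEquiv (σ (Sum.inr i))))))
        simp only [map_zsmul, LinearMap.mul'_apply]
        have h1 : Continuous fun v : Fin (k + l) → V =>
            α fun i => v (finSumFinEquiv (σ (Sum.inl i))) :=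
          α.coe_continuous.comp (by fun_prop)
        have h2 : Continuous fun v : Fin (k + l) → V =>
            β fun i => v (finSumFinEquiv (σ (Sum.inr i))) :=
          β.coe_continuous.comp (by fun_prop)
        exact (h1.mul h2).const_smul (Equiv.Perm.sign σ : ℤ) }

/-- The exterior powers `α ^ k = α ∧ ⋯ ∧ α` of a two-form; `α ^ 0 = 1`. -/
noncomputable def wedgePow (α : V [⋀^Fin 2]→L[ℝ] ℝ) : (k : ℕ) → V [⋀^Fin (2 * k)]→L[ℝ] ℝ
  | 0 => ContinuousAlternatingMap.constOfIsEmpty ℝ V (Fin 0) (1 : ℝ)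
  | k + 1 => wedge (wedgePow α k) α

end Wedge

/-! ## The operators `∂` and `∂̄` on an open part of a complex vector space -/

section Local

variable {E : Type*} [NormedAddCommGroup E] [NormedSpace ℂ E]

/-- `∂α` for a complex-valued form on `E`: the exterior derivative in which the derivative `Dα(y)`
is replaced by its complex linear part, that is, `∑ⱼ dzⱼ ∧ ∂α/∂zⱼ` in linear coordinates. -/
noncomputable def localDel {k : ℕ} (α : E → E [⋀^Fin k]→L[ℝ] ℂ) (y : E) :
    E [⋀^Fin (k + 1)]→L[ℝ] ℂ :=
  .alternatizeUncurryFin ((1 / 2 : ℂ) • (fderiv ℝ α y -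
    Complex.I • (fderiv ℝ α y).comp (Complex.I • ContinuousLinearMap.id ℝ E)))

/-- `∂̄α` for a complex-valued form on `E`: the exterior derivative in which the derivative `Dα(y)`
is replaced by its conjugate linear part, that is, `∑ⱼ dz̄ⱼ ∧ ∂α/∂z̄ⱼ` in linear coordinates. -/
noncomputable def localDelBar {k : ℕ} (α : E → E [⋀^Fin k]→L[ℝ] ℂ) (y : E) :
    E [⋀^Fin (k + 1)]→L[ℝ] ℂ :=
  .alternatizeUncurryFin ((1 / 2 : ℂ) • (fderiv ℝ α y +
    Complex.I • (fderiv ℝ α y).comp (Complex.I • ContinuousLinearMap.id ℝ E)))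

end Local

/-! ## Complex manifolds as smooth real manifolds -/

/-- A complex manifold is in particular a real analytic manifold, with the same charts. -/
instance IsManifold.realOfComplex {E : Type*} [NormedAddCommGroup E] [NormedSpace ℂ E]
    {M : Type*} [TopologicalSpace M] [ChartedSpace E M] [h : IsManifold 𝓘(ℂ, E) ω M] :
    IsManifold 𝓘(ℝ, E) ω M := by
  refine isManifold_of_contDiffOn 𝓘(ℝ, E) ω M fun e e' he he' => ?_
  have h1 := (contDiffGroupoid ω 𝓘(ℂ, E)).compatible he he'
  rw [contDiffGroupoid, mem_groupoid_of_pregroupoid] at h1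
  exact ContDiffOn.restrict_scalars ℝ h1.1

universe u

section Forms

variable {E : Type*} [NormedAddCommGroup E] [NormedSpace ℂ E]
variable {M : Type*} [TopologicalSpace M] [ChartedSpace E M]
variable {N : Type*} [TopologicalSpace N] [ChartedSpace E N]

variable (E M) in
/-- Differential `k`-forms on `M`, with values in `F` (no regularity imposed). A form is a family
of alternating forms on the tangent spaces; Mathlib's `TangentSpace 𝓘(ℝ, E) x` is by definition
the space `E`, the identification being given by the preferred chart `chartAt E x`. -/
abbrev DForm (k : ℕ) (F : Type*) [NormedAddCommGroup F] [NormedSpace ℝ F] :=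
  M → E [⋀^Fin k]→L[ℝ] F

variable {F : Type*} [NormedAddCommGroup F] [NormedSpace ℝ F]

variable (E) in
/-- The complex structure `I` on the tangent spaces, which Mathlib identifies with `E` through
holomorphic charts. -/
noncomputable def tangentI : E →L[ℝ] E := Complex.I • ContinuousLinearMap.id ℝ E

theorem tangentI_tangentI (v : E) : tangentI E (tangentI E v) = -v := by
  change Complex.I • (Complex.I • v) = -v
  rw [smul_smul, Complex.I_mul_I, neg_one_smul]

/-- The derivative at `x` of a map between manifolds, on tangent spaces. -/
noncomputable def tangentMapAt (f : N → M) (x : N) : E →L[ℝ] E :=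
  mfderiv 𝓘(ℝ, E) 𝓘(ℝ, E) f x

/-- Pull-back of a form along a map. -/
noncomputable def DForm.pullback {k : ℕ} (f : N → M) (α : DForm E M k F) : DForm E N k F :=
  fun x => (α (f x)).compContinuousLinearMap (tangentMapAt f x)

/-- The expression of a form in the chart `φ`: its pull-back along `φ⁻¹`, a form on `φ.target`. -/
noncomputable def DForm.inChart {k : ℕ} (φ : OpenPartialHomeomorph M E) (α : DForm E M k F) :
    E → E [⋀^Fin k]→L[ℝ] F :=
  DForm.pullback φ.symm α

/-- A form is smooth if its expression in each chart of the atlas is smooth. -/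
def DForm.IsSmooth {k : ℕ} (α : DForm E M k F) : Prop :=
  ∀ φ ∈ atlas E M, ContDiffOn ℝ ∞ (α.inChart φ) φ.target

/-- The form on `M` that a local operator `D` (defined on forms on open parts of `E`) gives:
at `x` it is computed in the preferred chart at `x`. -/
noncomputable def DForm.viaChart {k l : ℕ}
    (D : (E → E [⋀^Fin k]→L[ℝ] F) → E → E [⋀^Fin l]→L[ℝ] F) (α : DForm E M k F) :
    DForm E M l F :=
  fun x => DForm.pullback (chartAt E x) (D (α.inChart (chartAt E x))) x

/-- The exterior derivative. -/
noncomputable def DForm.d {k : ℕ} (α : DForm E M k F) : DForm E M (k + 1) F :=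
  α.viaChart extDeriv

/-- The operator `∂`. -/
noncomputable def DForm.del {k : ℕ} (α : DForm E M k ℂ) : DForm E M (k + 1) ℂ :=
  α.viaChart localDel

/-- The operator `∂̄`. -/
noncomputable def DForm.delBar {k : ℕ} (α : DForm E M k ℂ) : DForm E M (k + 1) ℂ :=
  α.viaChart localDelBar

/-- A real form seen as a complex-valued form. -/
noncomputable def DForm.toComplex {k : ℕ} (α : DForm E M k ℝ) : DForm E M k ℂ :=
  fun x => Complex.ofRealCLM.compContinuousAlternatingMap (α x)

/-- The one-form `df` of a real function `f`. -/
noncomputable def differential (f : M → ℝ) : DForm E M 1 ℝ :=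
  fun x => ContinuousAlternatingMap.ofSubsingleton ℝ E ℝ (0 : Fin 1)
    (mfderiv 𝓘(ℝ, E) 𝓘(ℝ, ℝ) f x)

/-- `α^c = α ∘ I` for a one-form `α`. -/
noncomputable def DForm.conj (α : DForm E M 1 ℝ) : DForm E M 1 ℝ :=
  fun x => (α x).compContinuousLinearMap (tangentI E)

/-- `d d^c f`, where `d^c f = (df)^c = df ∘ I`. -/
noncomputable def ddc (f : M → ℝ) : DForm E M 2 ℝ :=
  (differential f).conj.d

/-- The two-form `ω₀ = -d^c θ` of a one-form `θ`, where `d^c θ = d(θ^c)`; if `θ = df` locally, then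
`ω₀ = -dd^c f` there. -/
noncomputable def omegaZero (θ : DForm E M 1 ℝ) : DForm E M 2 ℝ :=
  -θ.conj.d

/-- A real two-form `η` is a semi-positive definite `(1,1)`-form if it is `I`-invariant (that is, of
type `(1,1)`) and `η(Iv, v) ≥ 0`, i.e. the symmetric form `η(I·, ·)` is positive semi-definite. For
the fundamental form `ω = g(·, I·)` of a Hermitian metric `g` one has `ω(Iv, w) = g(v, w)`. -/
def DForm.IsSemiPositive (η : DForm E M 2 ℝ) : Prop :=
  ∀ (x : M) (v w : E),
    η x ![tangentI E v, tangentI E w] = η x ![v, w] ∧ 0 ≤ η x ![tangentI E v, v]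

end Forms

/-! ## Hermitian metrics -/

section Hermitian

variable {E : Type*} [NormedAddCommGroup E] [NormedSpace ℂ E]

variable (E) in
/-- A (smooth) Hermitian metric on the complex manifold `M`: a smooth Riemannian metric for which
the complex structure is orthogonal. -/
structure HermitianMetric (M : Type*) [TopologicalSpace M] [ChartedSpace E M]
    [IsManifold 𝓘(ℂ, E) ω M] where
  /-- the underlying Riemannian metric -/
  metric : Bundle.ContMDiffRiemannianMetric 𝓘(ℝ, E) ∞ E
    (fun x : M => TangentSpace 𝓘(ℝ, E) x)
  inner_tangentI : ∀ (x : M) (v w : E),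
    metric.inner x (tangentI E v) (tangentI E w) = metric.inner x v w

variable {M : Type*} [TopologicalSpace M] [ChartedSpace E M] [IsManifold 𝓘(ℂ, E) ω M]
variable {X : Type*} [TopologicalSpace X] [ChartedSpace E X] [IsManifold 𝓘(ℂ, E) ω X]

/-- The metric as a bilinear form on the tangent space at `x`, identified with `E`. -/
noncomputable def HermitianMetric.bilin (g : HermitianMetric E M) (x : M) : E →L[ℝ] E →L[ℝ] ℝ :=
  g.metric.inner x

theorem HermitianMetric.bilin_self_tangentI (g : HermitianMetric E M) (x : M) (v : E) :
    g.bilin x v (tangentI E v) = 0 := by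
  have h : g.bilin x (tangentI E v) (tangentI E (tangentI E v)) = g.bilin x v (tangentI E v) :=
    g.inner_tangentI x v (tangentI E v)
  have hs : g.bilin x (tangentI E v) v = g.bilin x v (tangentI E v) := g.metric.symm x _ _
  rw [tangentI_tangentI, map_neg, hs] at h
  linarith

/-- The fundamental two-form `ω(v, w) = g(v, I w)` of a Hermitian metric. -/
noncomputable def HermitianMetric.form (g : HermitianMetric E M) : DForm E M 2 ℝ := fun x =>
  { toFun := fun v => g.bilin x (v 0) (tangentI E (v 1))
    map_update_add' := by
      intro _ v i a b
      fin_cases i <;> simp [Function.update]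
    map_update_smul' := by
      intro _ v i a b
      fin_cases i <;> simp [Function.update]
    map_eq_zero_of_eq' := by
      intro v i j hij hne
      have h01 : v 0 = v 1 := by
        fin_cases i <;> fin_cases j <;> simp_all
      rw [h01]
      exact g.bilin_self_tangentI x (v 1)
    cont := by fun_prop }

/-- `g` is Kähler: its fundamental form is closed. -/
def HermitianMetric.IsKaehler (g : HermitianMetric E M) : Prop :=
  g.form.d = 0

/-- `g` is Gauduchon: `∂∂̄ω^{n-1} = 0`, where `n` is the complex dimension. -/
def HermitianMetric.IsGauduchon (g : HermitianMetric E M) : Prop :=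
  (DForm.toComplex fun x => wedgePow (g.form x) (Module.finrank ℂ E - 1)).delBar.del = 0

/-- `(M, ω, θ)` is locally conformally Kähler with Lee form `θ`: `dω = θ ∧ ω` and `dθ = 0`. -/
structure IsLCK (g : HermitianMetric E M) (θ : DForm E M 1 ℝ) : Prop where
  smooth : θ.IsSmooth
  closed : θ.d = 0
  d_form : ∀ x, g.form.d x = wedge (θ x) (g.form x)

/-- `π : X → M` is a Kähler covering with Kähler metric `h` and global positive automorphic
potential `ψ`, compatible with the LCK structure `(g, θ)` on `M`. -/
structure IsPotentialCovering (g : HermitianMetric E M) (θ : DForm E M 1 ℝ)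
    (π : X → M) (h : HermitianMetric E X) (ψ : X → ℝ) : Prop where
  covering : IsCoveringMap π
  surjective : Function.Surjective π
  /-- the covering is locally biholomorphic -/
  holomorphic : IsLocalDiffeomorph 𝓘(ℂ, E) 𝓘(ℂ, E) ω π
  kaehler : h.IsKaehler
  /-- `ψ` is a smooth positive global potential of the Kähler metric -/
  smooth : ContMDiff 𝓘(ℝ, E) 𝓘(ℝ, ℝ) ∞ ψ
  pos : ∀ x, 0 < ψ x
  potential : h.form = ddc ψ
  /-- deck transformations are holomorphic homotheties that multiply `ψ` by the scale factor -/
  deck : ∀ γ : X ≃ₜ X, π ∘ γ = π → ContMDiff 𝓘(ℂ, E) 𝓘(ℂ, E) ω γ ∧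
    ∃ c : ℝ, 0 < c ∧ h.form.pullback γ = c • h.form ∧ ∀ x, ψ (γ x) = c * ψ x
  /-- `π^*ω = ψ⁻¹ dd^c ψ` -/
  pullback_form : ∀ x, g.form.pullback π x = (ψ x)⁻¹ • h.form x
  /-- `π^*θ = dν`, where `ψ = exp (-ν)` -/
  pullback_lee : θ.pullback π = differential fun x => -Real.log (ψ x)

end Hermitian

/-- `(M, ω, θ)` is an LCK manifold with potential: it is LCK and has a (connected) Kähler covering
with a global positive automorphic potential `ψ` such that `π^*ω = ψ⁻¹ dd^c ψ` and
`π^*θ = -d log ψ`. -/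
def IsLCKWithPotential {E : Type*} [NormedAddCommGroup E] [NormedSpace ℂ E]
    {M : Type u} [TopologicalSpace M] [ChartedSpace E M] [IsManifold 𝓘(ℂ, E) ω M]
    (g : HermitianMetric E M) (θ : DForm E M 1 ℝ) : Prop :=
  IsLCK g θ ∧
  ∃ (X : Type u) (_ : TopologicalSpace X) (_ : T2Space X) (_ : ConnectedSpace X)
    (_ : ChartedSpace E X) (_ : IsManifold 𝓘(ℂ, E) ω X)
    (π : X → M) (h : HermitianMetric E X) (ψ : X → ℝ), IsPotentialCovering g θ π h ψ

/-!
Let `n` be the complex dimension, `N = n - 1`, and let `p > 0` be the composition of the potential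
with a local section of the covering (`IsPotentialCovering.exists_localPotential`), so that locally
`ω = p⁻¹ dd^c p` and `θ = -d log p`. Computing `ω₀ = dd^c log p` gives `ω₀ = ω - θ ∧ θ^c`. Hence
`ω₀` is always of type `(1,1)`, and `ω₀(Iv, v) = g(v, v) - θ(v)² - θ(Iv)²`: semi-positivity of `ω₀`
is the pointwise inequality `|θ|² ≤ 1`
(`IsPotentialCovering.isSemiPositive_omegaZero_iff`).

On real forms `∂∂̄ = (i / 2) dd^c` (`del_delBar_toComplex`), so `g` is Gauduchon if and only if the
top form `dd^c ω^N` vanishes. From `ω = p⁻¹ dd^c p` and the closedness of `dd^c p` one computes that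
`dd^c ω^N` is, up to a positive constant, the alternation of `(-ω / 2 + n θ ⊗ θ^c) ⊗ ω^N`
(`two_pow_mul_extDeriv_localDc_wedgePow`); evaluated in a `g`-unitary basis adapted to `θ`, this is
a nonzero constant multiple of `1 - |θ|²` (`exists_basis_altSum_eq`). The constants contain the
factor `N`, which is where `n ≥ 2` is needed.

So if `g` is Gauduchon then `|θ|² = 1` everywhere, and `ω₀` is semi-positive. Conversely, if `ω₀` is
semi-positive, then the exact form `d(± d^c ω^N)` is nonnegative for the complex orientation. Its
integral over the compact manifold `M` is zero by Stokes' theorem, so it vanishes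
(`DForm.IsSmooth.d_eq_zero_of_nonneg`). Stokes' theorem is proved with a partition of unity
subordinate to finitely many charts; only the value on a fixed real basis of the model space is
integrated, and holomorphic transition maps multiply it by their (nonnegative) Jacobian.
-/

/-! ### Alternating sums over permutations -/

section AltSum

variable {ι κ V : Type*} [Fintype ι] [DecidableEq ι] [Fintype κ] [DecidableEq κ]

/-- The alternating sum of a function `f` of tuples of vectors over all the permutations of the
tuple `v`. The function `f` need not be multilinear. -/
def altSum (f : (ι → V) → ℝ) (v : ι → V) : ℝ :=
  ∑ σ : Equiv.Perm ι, ((Equiv.Perm.sign σ : ℤ) : ℝ) * f (v ∘ σ)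

theorem altSum_add (f g : (ι → V) → ℝ) (v : ι → V) :
    altSum (fun w => f w + g w) v = altSum f v + altSum g v := by
  simp only [altSum, mul_add, Finset.sum_add_distrib]

theorem altSum_sum {α : Type*} (s : Finset α) (f : α → (ι → V) → ℝ) (v : ι → V) :
    altSum (fun w => ∑ i ∈ s, f i w) v = ∑ i ∈ s, altSum (f i) v := by
  simp only [altSum, Finset.mul_sum]
  exact Finset.sum_comm

theorem altSum_const_mul (c : ℝ) (f : (ι → V) → ℝ) (v : ι → V) :
    altSum (fun w => c * f w) v = c * altSum f v := by
  simp only [altSum, Finset.mul_sum]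
  exact Finset.sum_congr rfl fun σ _ => by ring

theorem altSum_comp_perm (f : (ι → V) → ℝ) (τ : Equiv.Perm ι) (v : ι → V) :
    altSum (fun w => f (w ∘ τ)) v = ((Equiv.Perm.sign τ : ℤ) : ℝ) * altSum f v := by
  have hs : ((Equiv.Perm.sign τ : ℤ) : ℝ) * ((Equiv.Perm.sign τ : ℤ) : ℝ) = 1 := by
    rcases Int.units_eq_one_or (Equiv.Perm.sign τ) with h | h <;> simp [h]
  rw [altSum, altSum, Finset.mul_sum]
  refine Fintype.sum_equiv (Equiv.mulRight τ) _ _ fun σ => ?_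
  simp only [Equiv.coe_mulRight, map_mul, Units.val_mul, Int.cast_mul, Equiv.Perm.coe_mul,
    Function.comp_assoc]
  linear_combination (-(((Equiv.Perm.sign σ : ℤ) : ℝ) * f (v ∘ σ ∘ τ))) * hs

/-- Transport of an alternating sum along a bijection of the index types. -/
theorem altSum_comp_equiv (e : κ ≃ ι) (f : (κ → V) → ℝ) (v : ι → V) :
    altSum (fun w => f (w ∘ e)) v = altSum f (v ∘ e) := by
  refine Fintype.sum_equiv e.symm.permCongr _ _ fun σ => ?_
  have h : (v ∘ σ) ∘ e = (v ∘ e) ∘ e.symm.permCongr σ := by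
    ext i
    simp [Equiv.permCongr_apply]
  simp only [Equiv.Perm.sign_permCongr, h]

/-- A nested alternating sum, over a part of the indices inside a sum over all the indices, is a
multiple of a single alternating sum. -/
theorem altSum_altSum (j : κ ↪ ι) (F : (ι → V) → (κ → V) → ℝ)
    (hF : ∀ w w' u, (∀ i ∉ Set.range j, w i = w' i) → F w u = F w' u) (v : ι → V) :
    altSum (fun w => altSum (F w) (w ∘ j)) v =
      (Fintype.card κ).factorial * altSum (fun w => F w (w ∘ j)) v := by
  have h (τ : Equiv.Perm κ) : altSum (fun w => F w ((w ∘ j) ∘ τ)) v =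
      ((Equiv.Perm.sign τ : ℤ) : ℝ) * altSum (fun w => F w (w ∘ j)) v := by
    rw [← Equiv.Perm.viaFintypeEmbedding_sign τ j, ← altSum_comp_perm]
    congr 1
    ext w
    have h1 : (w ∘ τ.viaFintypeEmbedding j) ∘ j = (w ∘ j) ∘ τ := by
      ext a
      simp
    rw [h1]
    refine hF _ _ _ fun i hi => ?_
    simp [Equiv.Perm.viaFintypeEmbedding_apply_notMem_range τ j hi]
  change altSum (fun w => ∑ τ : Equiv.Perm κ, ((Equiv.Perm.sign τ : ℤ) : ℝ) *
    F w ((w ∘ j) ∘ τ)) v = _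
  rw [altSum_sum]
  simp only [altSum_const_mul, h]
  have hs (τ : Equiv.Perm κ) :
      ((Equiv.Perm.sign τ : ℤ) : ℝ) * ((Equiv.Perm.sign τ : ℤ) : ℝ) = 1 := by
    rcases Int.units_eq_one_or (Equiv.Perm.sign τ) with h | h <;> simp [h]
  simp only [← mul_assoc, hs, one_mul, Finset.sum_const, Finset.card_univ, Fintype.card_perm,
    nsmul_eq_mul]

/-- A term whose cyclic sum over three of the arguments vanishes has alternating sum zero. -/
theorem altSum_eq_zero_of_cyclic {i j k : ι} (hij : i ≠ j) (hjk : j ≠ k) (hik : i ≠ k)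
    (Z : V → V → V → ℝ) (R : (ι → V) → ℝ) (hZ : ∀ a b c, Z a b c + Z b c a + Z c a b = 0)
    (hR : ∀ w w', (∀ l, l ≠ i → l ≠ j → l ≠ k → w l = w' l) → R w = R w') (v : ι → V) :
    altSum (fun w => R w * Z (w i) (w j) (w k)) v = 0 := by
  set c : Equiv.Perm ι := Equiv.swap i j * Equiv.swap j k with hc
  have hci : c i = j := by
    simp [hc, Equiv.swap_apply_of_ne_of_ne hij hik]
  have hcj : c j = k := by
    simp [hc, Equiv.swap_apply_of_ne_of_ne hik.symm hjk.symm]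
  have hck : c k = i := by simp [hc]
  have hcl (l) (h1 : l ≠ i) (h2 : l ≠ j) (h3 : l ≠ k) : c l = l := by
    simp [hc, Equiv.swap_apply_of_ne_of_ne h2 h3, Equiv.swap_apply_of_ne_of_ne h1 h2]
  have hsign : Equiv.Perm.sign c = 1 := by
    simp [hc, Equiv.Perm.sign_swap hij, Equiv.Perm.sign_swap hjk]
  set f : (ι → V) → ℝ := fun w => R w * Z (w i) (w j) (w k) with hf
  have h1 : altSum (fun w => f (w ∘ c)) v = altSum f v := by
    rw [altSum_comp_perm, hsign]; simp
  have h2 : altSum (fun w => f ((w ∘ c) ∘ c)) v = altSum f v := by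
    rw [altSum_comp_perm (fun w => f (w ∘ c)) c, hsign, ← h1]; simp
  have h3 : altSum (fun w => (f w + f (w ∘ c)) + f ((w ∘ c) ∘ c)) v = 0 := by
    refine Finset.sum_eq_zero fun σ _ => ?_
    have e1 (w : ι → V) : R (w ∘ c) = R w := hR _ _ fun l h1 h2 h3 => by simp [hcl l h1 h2 h3]
    have := hZ ((v ∘ σ) i) ((v ∘ σ) j) ((v ∘ σ) k)
    simp only [hf, e1, Function.comp_apply, hci, hcj, hck] at this ⊢
    rw [← mul_add, ← mul_add, this]; simp
  rw [altSum_add, altSum_add, h1, h2] at h3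
  linarith

end AltSum

section FormsAltSum

variable {V : Type*} [AddCommGroup V] [Module ℝ V]

theorem altSum_alternatingMap {ι : Type*} [Fintype ι] [DecidableEq ι] (α : V [⋀^ι]→ₗ[ℝ] ℝ)
    (v : ι → V) : altSum α v = (Fintype.card ι).factorial * α v := by
  have h := congrArg (fun β : V [⋀^ι]→ₗ[ℝ] ℝ => β v) (AlternatingMap.coe_alternatization α)
  simp only [MultilinearMap.alternatization_apply] at h
  simpa [altSum, Units.smul_def, Function.comp_def] using h

theorem factorial_mul_alternatizeUncurryFin {m : ℕ} (A : V →ₗ[ℝ] V [⋀^Fin m]→ₗ[ℝ] ℝ)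
    (v : Fin (m + 1) → V) :
    (m.factorial : ℝ) * AlternatingMap.alternatizeUncurryFin A v =
      altSum (fun w => A (w 0) (w ∘ Fin.succ)) v := by
  have h := altSum_alternatingMap (AlternatingMap.alternatizeUncurryFin A) v
  have h2 : altSum (AlternatingMap.alternatizeUncurryFin A) v =
      (m + 1) * altSum (fun w => A (w 0) (w ∘ Fin.succ)) v := by
    have h3 : ⇑(AlternatingMap.alternatizeUncurryFin A) = fun w => ∑ i : Fin (m + 1),
        (((-1) ^ (i : ℕ) : ℝ) * A ((w ∘ i.cycleRange.symm) 0)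
          ((w ∘ i.cycleRange.symm) ∘ Fin.succ)) := by
      ext w
      rw [AlternatingMap.alternatizeUncurryFin_apply]
      refine Finset.sum_congr rfl fun i _ => ?_
      have : (w ∘ i.cycleRange.symm) ∘ Fin.succ = i.removeNth w := by
        ext j
        simp [Fin.removeNth]
      rw [this]
      simp
    rw [h3, altSum_sum]
    have h4 (i : Fin (m + 1)) : altSum (fun w => ((-1) ^ (i : ℕ) : ℝ) *
        A ((w ∘ i.cycleRange.symm) 0) ((w ∘ i.cycleRange.symm) ∘ Fin.succ)) v =
        altSum (fun w => A (w 0) (w ∘ Fin.succ)) v := by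
      rw [altSum_const_mul, altSum_comp_perm (fun w => A (w 0) (w ∘ Fin.succ)),
        Equiv.Perm.sign_symm, Fin.sign_cycleRange, ← mul_assoc]
      push_cast
      rw [← pow_add, Even.neg_one_pow ⟨_, rfl⟩, one_mul]
    simp only [h4, Finset.sum_const, Finset.card_univ, Fintype.card_fin, nsmul_eq_mul]
    push_cast
    rfl
  rw [h2, Fintype.card_fin, Nat.factorial_succ] at h
  have hm : ((m : ℝ) + 1) ≠ 0 := by positivity
  push_cast at h
  refine mul_left_cancel₀ hm ?_
  rw [h, mul_assoc]

variable [TopologicalSpace V]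

theorem factorial_mul_wedge {k l : ℕ} (α : V [⋀^Fin k]→L[ℝ] ℝ) (β : V [⋀^Fin l]→L[ℝ] ℝ)
    (v : Fin (k + l) → V) :
    (k.factorial * l.factorial : ℝ) * wedge α β v =
      altSum (fun w => α (w ∘ Fin.castAdd l) * β (w ∘ Fin.natAdd k)) v := by
  have h := congrArg (fun γ : V [⋀^Fin k ⊕ Fin l]→ₗ[ℝ] (ℝ ⊗[ℝ] ℝ) =>
    LinearMap.mul' ℝ ℝ (γ (v ∘ finSumFinEquiv)))
    (MultilinearMap.domCoprod_alternization_eq α.toAlternatingMap β.toAlternatingMap)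
  simp only [MultilinearMap.alternatization_apply, map_sum, AlternatingMap.smul_apply, map_nsmul,
    Fintype.card_fin] at h
  have e : (LinearMap.mul' ℝ ℝ) ((α.toAlternatingMap.domCoprod β.toAlternatingMap)
    (v ∘ finSumFinEquiv)) = wedge α β v := rfl
  rw [e, nsmul_eq_mul] at h
  push_cast at h
  rw [← h]
  have h2 := altSum_comp_equiv (finSumFinEquiv (m := k) (n := l)) (V := V)
    (fun w => α (w ∘ Sum.inl) * β (w ∘ Sum.inr)) v
  have h3 (w : Fin (k + l) → V) : (w ∘ finSumFinEquiv) ∘ Sum.inl = w ∘ Fin.castAdd l := rfl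
  have h4 (w : Fin (k + l) → V) : (w ∘ finSumFinEquiv) ∘ Sum.inr = w ∘ Fin.natAdd k := rfl
  simp only [h3, h4] at h2
  rw [h2]
  refine Finset.sum_congr rfl fun σ _ => ?_
  rw [Units.smul_def, map_zsmul, zsmul_eq_mul]
  rfl

/-- The `s`-th member of the `i`-th pair `(2 i, 2 i + 1)` of indices below `2 k`. -/
def pairIndex {k : ℕ} (i : Fin k) (s : Fin 2) : Fin (2 * k) :=
  ⟨2 * i + s, by omega⟩

theorem two_pow_mul_wedgePow (η : V [⋀^Fin 2]→L[ℝ] ℝ) (k : ℕ) (v : Fin (2 * k) → V) :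
    (2 ^ k : ℝ) * wedgePow η k v =
      altSum (fun w => ∏ i : Fin k, η ![w (pairIndex i 0), w (pairIndex i 1)]) v := by
  induction k with
  | zero =>
    have : Subsingleton (Equiv.Perm (Fin (2 * 0))) :=
      inferInstanceAs (Subsingleton (Equiv.Perm (Fin 0)))
    have h1 : (Finset.univ : Finset (Equiv.Perm (Fin (2 * 0)))) = {1} := by
      ext σ; simp [Subsingleton.elim σ 1]
    simp only [altSum, h1]
    simp [wedgePow]
  | succ k ih =>
    have h := factorial_mul_wedge (wedgePow η k) η v
    have h2 : altSum (fun w => altSum (fun u => (∏ i : Fin k,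
        η ![u (pairIndex i 0), u (pairIndex i 1)]) * η (w ∘ Fin.natAdd (2 * k)))
          (w ∘ Fin.castAddEmb 2)) v = (2 * k).factorial * altSum (fun w => (∏ i : Fin k,
        η ![w (Fin.castAdd 2 (pairIndex i 0)), w (Fin.castAdd 2 (pairIndex i 1))]) *
          η (w ∘ Fin.natAdd (2 * k))) v := by
      rw [altSum_altSum (Fin.castAddEmb 2) (fun w u => (∏ i : Fin k,
        η ![u (pairIndex i 0), u (pairIndex i 1)]) * η (w ∘ Fin.natAdd (2 * k))), Fintype.card_fin]
      · rfl
      · intro w w' u hw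
        have : w ∘ Fin.natAdd (2 * k) = w' ∘ Fin.natAdd (2 * k) := by
          ext i
          refine hw _ ?_
          rintro ⟨j, hj⟩
          have := congrArg Fin.val hj
          simp at this
          omega
        simp only [this]
    have h3 : altSum (fun w => altSum (fun u => (∏ i : Fin k,
        η ![u (pairIndex i 0), u (pairIndex i 1)]) * η (w ∘ Fin.natAdd (2 * k)))
          (w ∘ Fin.castAddEmb 2)) v =
        2 ^ k * ((2 * k).factorial * 2 * wedge (wedgePow η k) η v) := by
      have h4 : ((2 : ℕ).factorial : ℝ) = 2 := by norm_num
      rw [h4] at h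
      rw [h, ← altSum_const_mul]
      congr 1
      ext w
      rw [← mul_assoc]
      simp_rw [mul_comm _ (η _)]
      rw [altSum_const_mul, ← ih]
      rfl
    have h5 : altSum (fun w => (∏ i : Fin k,
        η ![w (Fin.castAdd 2 (pairIndex i 0)), w (Fin.castAdd 2 (pairIndex i 1))]) *
          η (w ∘ Fin.natAdd (2 * k))) v =
        altSum (fun w => ∏ i : Fin (k + 1), η ![w (pairIndex i 0), w (pairIndex i 1)]) v := by
      congr 1
      ext w
      rw [Fin.prod_univ_castSucc]
      congr 2
      ext i
      fin_cases i <;> rfl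
    rw [← h5]
    have hf : ((2 * k).factorial : ℝ) ≠ 0 := by positivity
    refine mul_left_cancel₀ hf ?_
    rw [← h2, h3, wedgePow]
    ring

end FormsAltSum

/-! ### The operator `d^c` on an open part of a complex vector space -/

section LocalDc

variable {E : Type*} [NormedAddCommGroup E] [NormedSpace ℂ E]
variable {F : Type*} [NormedAddCommGroup F] [NormedSpace ℝ F]

/-- The exterior derivative in which the derivative `Dα(y)` is precomposed with the complex
structure, so that `∂ = (d - i d^c) / 2` and `∂̄ = (d + i d^c) / 2`. On functions it is
`df ∘ I`. In positive degree it differs from `d(α ∘ I)`, the convention for one-forms in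
`omegaZero`: for `α = df` it gives `-d(df ∘ I)`. -/
noncomputable def localDc {k : ℕ} (α : E → E [⋀^Fin k]→L[ℝ] F) (y : E) :
    E [⋀^Fin (k + 1)]→L[ℝ] F :=
  .alternatizeUncurryFin ((fderiv ℝ α y).comp (tangentI E))

/-- The flat expression of `dd^c f` for a real function `f` on a complex vector space. -/
noncomputable def localDdc (f : E → ℝ) (y : E) : E [⋀^Fin 2]→L[ℝ] ℝ :=
  extDeriv (fun z => ContinuousAlternatingMap.ofSubsingleton ℝ E ℝ (0 : Fin 1)
    ((fderiv ℝ f z).comp (tangentI E))) y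

/-- A family of alternating forms on a finite-dimensional space is smooth if all of its values on
fixed tuples of vectors are. -/
theorem contDiffAt_alternatingMap_of_apply [FiniteDimensional ℂ E] {k : ℕ} {n : WithTop ℕ∞}
    {α : E → E [⋀^Fin k]→L[ℝ] ℝ} {y : E}
    (h : ∀ v : Fin k → E, ContDiffAt ℝ n (fun z => α z v) y) : ContDiffAt ℝ n α y := by
  have : FiniteDimensional ℝ E := FiniteDimensional.complexToReal E
  let b := Module.finBasis ℝ E
  let ev : (E [⋀^Fin k]→L[ℝ] ℝ) →ₗ[ℝ] ((Fin k → Fin (Module.finrank ℝ E)) → ℝ) :=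
    { toFun := fun β f => β (b ∘ f)
      map_add' := fun _ _ => rfl
      map_smul' := fun _ _ => rfl }
  have hev : LinearMap.ker ev = ⊥ := by
    refine LinearMap.ker_eq_bot'.2 fun β hβ => ?_
    have : β.toAlternatingMap = 0 := by
      refine Module.Basis.ext_alternating b fun f _ => ?_
      exact congrFun hβ f
    ext v
    exact congrArg (fun γ : E [⋀^Fin k]→ₗ[ℝ] ℝ => γ v) this
  obtain ⟨L, hL⟩ := LinearMap.exists_leftInverse_of_injective ev hev
  have h1 : ContDiffAt ℝ n (fun z => ev (α z)) y :=
    contDiffAt_pi.2 fun f => h (b ∘ f)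
  have h2 : α = fun z => LinearMap.toContinuousLinearMap L (ev (α z)) := by
    ext z : 1
    exact (LinearMap.congr_fun hL (α z)).symm
  rw [h2]
  exact (LinearMap.toContinuousLinearMap L).contDiff.contDiffAt.comp y h1

theorem contDiffAt_wedgePow [FiniteDimensional ℂ E] {n : WithTop ℕ∞}
    {η : E → E [⋀^Fin 2]→L[ℝ] ℝ} {y : E} (h : ContDiffAt ℝ n η y) (k : ℕ) :
    ContDiffAt ℝ n (fun z => wedgePow (η z) k) y := by
  refine contDiffAt_alternatingMap_of_apply fun v => ?_
  have h1 : (fun z => wedgePow (η z) k v) = fun z => (2 ^ k : ℝ)⁻¹ *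
      altSum (fun w => ∏ i : Fin k, η z ![w (pairIndex i 0), w (pairIndex i 1)]) v := by
    ext z
    rw [← two_pow_mul_wedgePow, inv_mul_cancel_left₀ (by positivity)]
  have h2 (u : Fin 2 → E) : ContDiffAt ℝ n (fun z => η z u) y :=
    (ContinuousAlternatingMap.apply ℝ E ℝ u).contDiff.contDiffAt.comp y h
  rw [h1]
  unfold altSum
  refine contDiffAt_const.mul (ContDiffAt.sum fun σ _ => contDiffAt_const.mul ?_)
  exact contDiffAt_prod fun i _ => h2 _

theorem localDdc_apply {f : E → ℝ} {y : E} (hf : ContDiffAt ℝ 2 f y) (v w : E) :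
    localDdc f y ![v, w] =
      fderiv ℝ (fderiv ℝ f) y v (tangentI E w) - fderiv ℝ (fderiv ℝ f) y w (tangentI E v) := by
  have h1 : DifferentiableAt ℝ (fderiv ℝ f) y :=
    (hf.fderiv_right (m := 1) (by norm_num)).differentiableAt (by norm_num)
  have h2 : DifferentiableAt ℝ (fun z => ContinuousAlternatingMap.ofSubsingleton ℝ E ℝ (0 : Fin 1)
      ((fderiv ℝ f z).comp (tangentI E))) y := by
    have h3 : DifferentiableAt ℝ (fun z => (fderiv ℝ f z).comp (tangentI E)) y :=
      h1.clm_comp (differentiableAt_const _)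
    exact ((ContinuousAlternatingMap.ofSubsingletonLIE (𝕜 := ℝ) (E := E) (F := ℝ)
      (0 : Fin 1)).toContinuousLinearEquiv.differentiableAt).comp y h3
  have h4 (a b : E) : fderiv ℝ (fun z => fderiv ℝ f z b) y a = fderiv ℝ (fderiv ℝ f) y a b := by
    rw [fderiv_clm_apply h1 (differentiableAt_const _)]
    simp
  rw [localDdc, extDeriv_apply h2]
  simp [Fin.sum_univ_two, Fin.removeNth, h4, sub_eq_add_neg]

/-- In the alternating sum of the derivatives of `c ∏ Ω` only `c` needs to be differentiated, if the
cyclic sums of the derivative of the two-form `Ω` along `L` vanish: for `L = 1` this says that `Ω`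
is closed, for `L = I` that it is `d^c`-closed. -/
theorem altSum_fderiv_mul_prod {ι : Type*} [Fintype ι] [DecidableEq ι] {N : ℕ} {x : E}
    (c : (ι → E) → E → ℝ) (Ω : E → E [⋀^Fin 2]→L[ℝ] ℝ) (L : E →L[ℝ] E)
    (i₀ : ι) (q : Fin N → Fin 2 → ι)
    (hq : ∀ i s i' s', q i s = q i' s' → i = i' ∧ s = s') (hq₀ : ∀ i s, q i s ≠ i₀)
    (hc : ∀ w, DifferentiableAt ℝ (c w) x) (hΩ : DifferentiableAt ℝ Ω x)
    (hcw : ∀ w w', (∀ l, l ≠ i₀ → (∀ i s, l ≠ q i s) → w l = w' l) → c w = c w')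
    (hL : ∀ a b d, fderiv ℝ Ω x (L a) ![b, d] + fderiv ℝ Ω x (L b) ![d, a] +
      fderiv ℝ Ω x (L d) ![a, b] = 0) (v : ι → E) :
    altSum (fun w => fderiv ℝ (fun y => c w y * ∏ i, Ω y ![w (q i 0), w (q i 1)]) x
      (L (w i₀))) v =
    altSum (fun w => fderiv ℝ (c w) x (L (w i₀)) * ∏ i, Ω x ![w (q i 0), w (q i 1)]) v := by
  have h1 (w : ι → E) : fderiv ℝ (fun y => c w y * ∏ i, Ω y ![w (q i 0), w (q i 1)]) x
      (L (w i₀)) = fderiv ℝ (c w) x (L (w i₀)) * ∏ i, Ω x ![w (q i 0), w (q i 1)] +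
        ∑ i, (c w x * ∏ j ∈ Finset.univ.erase i, Ω x ![w (q j 0), w (q j 1)]) *
          fderiv ℝ Ω x (L (w i₀)) ![w (q i 0), w (q i 1)] := by
    have h2 := (hc w).hasFDerivAt.fun_mul (HasFDerivAt.finsetProd (u := Finset.univ)
      fun i _ => hΩ.hasFDerivAt.continuousAlternatingMap_apply_const
        ![w (q i 0), w (q i 1)])
    rw [h2.fderiv]
    simp only [_root_.add_apply, _root_.smul_apply,
      _root_.sum_apply, smul_eq_mul, Finset.mul_sum]
    rw [add_comm]
    congr 1
    · ring
    · refine Finset.sum_congr rfl fun i _ => ?_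
      rw [mul_assoc]
      rfl
  simp only [h1]
  rw [altSum_add, altSum_sum]
  refine add_eq_left.2 (Finset.sum_eq_zero fun i _ => ?_)
  refine altSum_eq_zero_of_cyclic (i := i₀) (j := q i 0) (k := q i 1) (hq₀ i 0).symm
    (fun h => absurd (hq _ _ _ _ h).2 (by decide)) (hq₀ i 1).symm
    (fun a b d => fderiv ℝ Ω x (L a) ![b, d])
    (fun w => c w x * ∏ j ∈ Finset.univ.erase i, Ω x ![w (q j 0), w (q j 1)]) hL ?_ v
  intro w w' hw
  have h2 : c w = c w' := hcw w w' fun l h1 h2 => hw l h1 (h2 i 0) (h2 i 1)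
  simp only [h2]
  congr 1
  refine Finset.prod_congr rfl fun j hj => ?_
  have hji := Finset.ne_of_mem_erase hj
  rw [hw (q j 0) (hq₀ j 0) (fun h => hji (hq _ _ _ _ h).1) (fun h => hji (hq _ _ _ _ h).1),
    hw (q j 1) (hq₀ j 1) (fun h => hji (hq _ _ _ _ h).1) (fun h => hji (hq _ _ _ _ h).1)]

end LocalDc

/-! ### The Gauduchon form of a metric with potential -/

section FlatComputation

variable {E : Type*} [NormedAddCommGroup E] [NormedSpace ℂ E]
variable {F : Type*} [NormedAddCommGroup F] [NormedSpace ℝ F]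

theorem two_le_infty : (2 : WithTop ℕ∞) ≤ ∞ := ENat.LEInfty.out

theorem contDiffAt_fderiv_infty {f : E → F} {y : E} (hf : ContDiffAt ℝ ∞ f y) :
    ContDiffAt ℝ ∞ (fderiv ℝ f) y :=
  hf.fderiv_right (m := ∞) (mod_cast le_top)

theorem contDiffAt_extDeriv {k : ℕ} {α : E → E [⋀^Fin k]→L[ℝ] F} {y : E}
    (h : ContDiffAt ℝ ∞ α y) : ContDiffAt ℝ ∞ (extDeriv α) y :=
  ContDiffAt.comp (g := ContinuousAlternatingMap.alternatizeUncurryFinCLM ℝ E F) y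
    (ContinuousLinearMap.contDiff _).contDiffAt (contDiffAt_fderiv_infty h)

theorem contDiffAt_localDc {k : ℕ} {α : E → E [⋀^Fin k]→L[ℝ] F} {y : E}
    (h : ContDiffAt ℝ ∞ α y) : ContDiffAt ℝ ∞ (localDc α) y :=
  ContDiffAt.comp (g := ContinuousAlternatingMap.alternatizeUncurryFinCLM ℝ E F)
    (f := fun z => (fderiv ℝ α z).comp (tangentI E)) y
    (ContinuousLinearMap.contDiff _).contDiffAt
    ((contDiffAt_fderiv_infty h).clm_comp contDiffAt_const)

theorem contDiffAt_localDdc {f : E → ℝ} {y : E} (hf : ContDiffAt ℝ ∞ f y) :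
    ContDiffAt ℝ ∞ (localDdc f) y := by
  refine contDiffAt_extDeriv ?_
  have h3 : ContDiffAt ℝ ∞ (fun z => (fderiv ℝ f z).comp (tangentI E)) y :=
    (contDiffAt_fderiv_infty hf).clm_comp contDiffAt_const
  exact ((ContinuousAlternatingMap.ofSubsingletonLIE (𝕜 := ℝ) (E := E) (F := ℝ)
    (0 : Fin 1)).toContinuousLinearEquiv.contDiff.contDiffAt).comp y h3

theorem fderiv_fderiv_comm {f : E → F} {y : E} (hf : ContDiffAt ℝ 2 f y) (a b : E) :
    fderiv ℝ (fderiv ℝ f) y a b = fderiv ℝ (fderiv ℝ f) y b a :=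
  hf.isSymmSndFDerivAt (by simp) a b

theorem fderiv_apply_const {G : Type*} [NormedAddCommGroup G] [NormedSpace ℝ G]
    {A : E → G →L[ℝ] F} {y : E} (hA : DifferentiableAt ℝ A y) (a : E) (b : G) :
    fderiv ℝ (fun z => A z b) y a = fderiv ℝ A y a b := by
  rw [fderiv_clm_apply hA (differentiableAt_const _)]
  simp

theorem eventually_contDiffAt_two {f : E → F} {y : E} (hf : ContDiffAt ℝ ∞ f y) :
    ∀ᶠ z in 𝓝 y, ContDiffAt ℝ 2 f z :=
  (hf.of_le (m := 2) two_le_infty).eventually (by simp)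

theorem fderiv_fderiv_fderiv_apply {f : E → ℝ} {y : E} (hf : ContDiffAt ℝ ∞ f y) (a b d : E) :
    fderiv ℝ (fun z => fderiv ℝ (fderiv ℝ f) z b d) y a =
      fderiv ℝ (fderiv ℝ (fderiv ℝ f)) y a b d := by
  have h3 : DifferentiableAt ℝ (fderiv ℝ (fderiv ℝ f)) y :=
    (contDiffAt_fderiv_infty (contDiffAt_fderiv_infty hf)).differentiableAt (by simp)
  rw [fderiv_apply_const (h3.clm_apply (differentiableAt_const b)), fderiv_apply_const h3]

theorem fderiv_localDdc_apply {f : E → ℝ} {y : E} (hf : ContDiffAt ℝ ∞ f y) (a v w : E) :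
    fderiv ℝ (localDdc f) y a ![v, w] =
      fderiv ℝ (fderiv ℝ (fderiv ℝ f)) y a v (tangentI E w) -
        fderiv ℝ (fderiv ℝ (fderiv ℝ f)) y a w (tangentI E v) := by
  have h1 := (contDiffAt_localDdc hf).differentiableAt (by simp)
  rw [← fderiv_continuousAlternatingMap_apply_const_apply h1]
  have h2 : (fun z => localDdc f z ![v, w]) =ᶠ[𝓝 y] fun z =>
      fderiv ℝ (fderiv ℝ f) z v (tangentI E w) - fderiv ℝ (fderiv ℝ f) z w (tangentI E v) :=
    (eventually_contDiffAt_two hf).mono fun z hz => localDdc_apply hz v w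
  have h3 : DifferentiableAt ℝ (fderiv ℝ (fderiv ℝ f)) y :=
    (contDiffAt_fderiv_infty (contDiffAt_fderiv_infty hf)).differentiableAt (by simp)
  have h4 (b d : E) : DifferentiableAt ℝ (fun z => fderiv ℝ (fderiv ℝ f) z b d) y :=
    (h3.clm_apply (differentiableAt_const b)).clm_apply (differentiableAt_const d)
  rw [h2.fderiv_eq, fderiv_fun_sub (h4 _ _) (h4 _ _), _root_.sub_apply,
    fderiv_fderiv_fderiv_apply hf, fderiv_fderiv_fderiv_apply hf]

/-- The third derivative is symmetric in its last two arguments. -/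
theorem fderiv_fderiv_fderiv_comm {f : E → ℝ} {y : E} (hf : ContDiffAt ℝ ∞ f y) (a b d : E) :
    fderiv ℝ (fderiv ℝ (fderiv ℝ f)) y a b d = fderiv ℝ (fderiv ℝ (fderiv ℝ f)) y a d b := by
  have h5 : (fun z => fderiv ℝ (fderiv ℝ f) z b d) =ᶠ[𝓝 y]
      fun z => fderiv ℝ (fderiv ℝ f) z d b :=
    (eventually_contDiffAt_two hf).mono fun z hz => fderiv_fderiv_comm hz b d
  rw [← fderiv_fderiv_fderiv_apply hf, h5.fderiv_eq, fderiv_fderiv_fderiv_apply hf]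

/-- The form `dd^c f` is closed. -/
theorem localDdc_cyclic {f : E → ℝ} {y : E} (hf : ContDiffAt ℝ ∞ f y) (a b d : E) :
    fderiv ℝ (localDdc f) y a ![b, d] + fderiv ℝ (localDdc f) y b ![d, a] +
      fderiv ℝ (localDdc f) y d ![a, b] = 0 := by
  have hs := fderiv_fderiv_comm ((contDiffAt_fderiv_infty hf).of_le (m := 2) two_le_infty)
  simp only [fderiv_localDdc_apply hf, hs b a, hs d b, hs d a]
  ring

/-- The form `dd^c f` is `d^c`-closed. -/
theorem localDdc_cyclic_tangentI {f : E → ℝ} {y : E} (hf : ContDiffAt ℝ ∞ f y) (a b d : E) :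
    fderiv ℝ (localDdc f) y (tangentI E a) ![b, d] +
      fderiv ℝ (localDdc f) y (tangentI E b) ![d, a] +
      fderiv ℝ (localDdc f) y (tangentI E d) ![a, b] = 0 := by
  have hs := fderiv_fderiv_comm ((contDiffAt_fderiv_infty hf).of_le (m := 2) two_le_infty)
  have ht := fderiv_fderiv_fderiv_comm hf
  simp only [fderiv_localDdc_apply hf]
  have e (u v w : E) : fderiv ℝ (fderiv ℝ (fderiv ℝ f)) y (tangentI E u) v (tangentI E w) =
      fderiv ℝ (fderiv ℝ (fderiv ℝ f)) y (tangentI E w) v (tangentI E u) := by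
    rw [hs, ht, hs]
  linear_combination e a b d - e a d b - e b a d

theorem factorial_mul_localDc {k : ℕ} {α : E → E [⋀^Fin k]→L[ℝ] ℝ} {y : E}
    (v : Fin (k + 1) → E) : (k.factorial : ℝ) * localDc α y v =
      altSum (fun w => fderiv ℝ α y (tangentI E (w 0)) (w ∘ Fin.succ)) v := by
  have h := factorial_mul_alternatizeUncurryFin
    ((ContinuousAlternatingMap.toAlternatingMapLinear (R := ℝ)).comp
      ((fderiv ℝ α y).comp (tangentI E)).toLinearMap) v
  rw [AlternatingMap.alternatizeUncurryFin_apply] at h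
  rw [localDc, ContinuousAlternatingMap.alternatizeUncurryFin_apply]
  exact h

theorem factorial_mul_extDeriv {k : ℕ} {α : E → E [⋀^Fin k]→L[ℝ] ℝ} {y : E}
    (v : Fin (k + 1) → E) : (k.factorial : ℝ) * extDeriv α y v =
      altSum (fun w => fderiv ℝ α y (w 0) (w ∘ Fin.succ)) v := by
  have h := factorial_mul_alternatizeUncurryFin
    ((ContinuousAlternatingMap.toAlternatingMapLinear (R := ℝ)).comp
      (fderiv ℝ α y).toLinearMap) v
  rw [AlternatingMap.alternatizeUncurryFin_apply] at h
  rw [extDeriv, ContinuousAlternatingMap.alternatizeUncurryFin_apply]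
  exact h

/-- If the values of a form are alternating sums of functions, the alternating sum that defines the
(twisted) exterior derivative absorbs the inner sum. -/
theorem altSum_fderiv_of_altSum {k : ℕ} {α : E → E [⋀^Fin k]→L[ℝ] ℝ} {y : E} {c : ℝ}
    (hα : DifferentiableAt ℝ α y) (G : (Fin k → E) → E → ℝ)
    (hG : ∀ w, DifferentiableAt ℝ (G w) y)
    (h : ∀ᶠ z in 𝓝 y, ∀ v, c * α z v = altSum (fun w => G w z) v)
    (L : E →L[ℝ] E) (v : Fin (k + 1) → E) :
    c * altSum (fun w => fderiv ℝ α y (L (w 0)) (w ∘ Fin.succ)) v =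
      k.factorial * altSum (fun w => fderiv ℝ (G (w ∘ Fin.succ)) y (L (w 0))) v := by
  have h1 (a : E) (u : Fin k → E) : c * fderiv ℝ α y a u =
      altSum (fun w => fderiv ℝ (G w) y a) u := by
    have h2 : (fun z => c * α z u) =ᶠ[𝓝 y] fun z => altSum (fun w => G w z) u :=
      h.mono fun z hz => hz u
    have h3 := h2.fderiv_eq (𝕜 := ℝ)
    rw [fderiv_const_mul (hα.continuousAlternatingMap_apply_const u)] at h3
    have h4 : HasFDerivAt (fun z => altSum (fun w => G w z) u)
        (∑ σ : Equiv.Perm (Fin k), ((Equiv.Perm.sign σ : ℤ) : ℝ) • fderiv ℝ (G (u ∘ σ)) y) y :=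
      HasFDerivAt.fun_sum fun σ _ => (hG _).hasFDerivAt.const_mul _
    rw [h4.fderiv] at h3
    have h5 := congrArg (fun A : E →L[ℝ] ℝ => A a) h3
    simp only [_root_.smul_apply, smul_eq_mul, _root_.sum_apply] at h5
    rw [fderiv_continuousAlternatingMap_apply_const_apply hα] at h5
    exact h5
  rw [← altSum_const_mul]
  simp only [h1]
  have h6 := altSum_altSum (Fin.succEmb k) (fun (w : Fin (k + 1) → E) (u : Fin k → E) =>
    fderiv ℝ (G u) y (L (w 0))) (fun w w' u hw => by
      rw [hw 0]
      rintro ⟨j, hj⟩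
      exact Fin.succ_ne_zero j hj) v
  rw [Fintype.card_fin] at h6
  exact h6

theorem Filter.EventuallyEq.localDc {k : ℕ} {α β : E → E [⋀^Fin k]→L[ℝ] F} {y : E}
    (h : α =ᶠ[𝓝 y] β) : _root_.localDc α =ᶠ[𝓝 y] _root_.localDc β :=
  (h.fderiv (𝕜 := ℝ)).mono fun z hz => by simp only [_root_.localDc, hz]

/-- The form `d d^c ω^N` for `ω = p⁻¹ dd^c p`. Since `dd^c p` is closed and `d^c`-closed, only the
factor `p⁻ᴺ` is differentiated; its second derivatives are computed with `θ = -d log p`. -/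
theorem two_pow_mul_extDeriv_localDc_wedgePow [FiniteDimensional ℂ E] {N : ℕ} {p : E → ℝ} {y₀ : E}
    {η : E → E [⋀^Fin 2]→L[ℝ] ℝ} (hp : ∀ᶠ y in 𝓝 y₀, ContDiffAt ℝ ∞ p y) (hpos : p y₀ ≠ 0)
    (hη : η =ᶠ[𝓝 y₀] fun y => (p y)⁻¹ • localDdc p y) (v : Fin (2 * N + 1 + 1) → E) :
    2 ^ N * extDeriv (localDc fun y => wedgePow (η y) N) y₀ v =
      N * altSum (fun w => (-(1 / 2) * η y₀ ![w 0, w 1] +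
        (N + 1) * ((p y₀)⁻¹ * fderiv ℝ p y₀ (w 0)) *
          ((p y₀)⁻¹ * fderiv ℝ p y₀ (tangentI E (w 1)))) *
        ∏ i : Fin N, η y₀ ![w (pairIndex i 0).succ.succ, w (pairIndex i 1).succ.succ]) v := by
  have hp₀ := hp.self_of_nhds
  set Ω := localDdc p with hΩ
  set u : E → ℝ := fun y => (p y ^ N)⁻¹ with hu
  have hne : ∀ᶠ y in 𝓝 y₀, p y ≠ 0 := hp₀.continuousAt.eventually_ne hpos
  have hu_smooth : ∀ᶠ y in 𝓝 y₀, ContDiffAt ℝ ∞ u y := by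
    filter_upwards [hp, hne] with y h1 h2
    exact (h1.pow N).inv (pow_ne_zero N h2)
  have hη_smooth : ∀ᶠ y in 𝓝 y₀, ContDiffAt ℝ ∞ η y := by
    filter_upwards [hp, hne, hη.eventuallyEq_nhds] with y h1 h2 h3
    exact ((h1.inv h2).smul (contDiffAt_localDdc h1)).congr_of_eventuallyEq h3
  have hα_smooth : ∀ᶠ y in 𝓝 y₀, ContDiffAt ℝ ∞ (fun y => wedgePow (η y) N) y :=
    hη_smooth.mono fun y h => contDiffAt_wedgePow h N
  -- The values of `ω^N` are alternating sums of products of a power of `p` and values of `dd^c p`.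
  have hvalue : ∀ᶠ y in 𝓝 y₀, ∀ v, 2 ^ N * wedgePow (η y) N v =
      altSum (fun w => u y * ∏ i : Fin N, Ω y ![w (pairIndex i 0), w (pairIndex i 1)]) v := by
    filter_upwards [hη] with y hy v
    rw [two_pow_mul_wedgePow]
    congr 1
    ext w
    rw [hy]
    simp only [ContinuousAlternatingMap.smul_apply, smul_eq_mul]
    rw [Finset.prod_mul_distrib, Finset.prod_const, Finset.card_univ, Fintype.card_fin, inv_pow]
  have hΩ_apply (y : E) (h : ContDiffAt ℝ ∞ p y) (a : Fin 2 → E) :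
      DifferentiableAt ℝ (fun z => Ω z a) y :=
    ((contDiffAt_localDdc h).differentiableAt (by simp)).continuousAlternatingMap_apply_const a
  have hprod (y : E) (h : ContDiffAt ℝ ∞ p y) (a : Fin N → Fin 2 → E) :
      DifferentiableAt ℝ (fun z => ∏ i, Ω z (a i)) y :=
    (HasFDerivAt.finsetProd (u := Finset.univ)
      fun i _ => (hΩ_apply y h (a i)).hasFDerivAt).differentiableAt
  -- The values of `d^c ω^N`.
  have hdc : ∀ᶠ y in 𝓝 y₀, ∀ v, 2 ^ N * localDc (fun y => wedgePow (η y) N) y v =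
      altSum (fun w => fderiv ℝ u y (tangentI E (w 0)) *
        ∏ i : Fin N, Ω y ![w (pairIndex i 0).succ, w (pairIndex i 1).succ]) v := by
    filter_upwards [hp, hu_smooth, hα_smooth, hvalue.eventually_nhds] with y h1 h2 h3 h4 v
    have h5 := altSum_fderiv_of_altSum (h3.differentiableAt (by simp))
      (fun w z => u z * ∏ i : Fin N, Ω z ![w (pairIndex i 0), w (pairIndex i 1)])
      (fun w => (h2.differentiableAt (by simp)).mul (hprod y h1 _)) h4 (tangentI E) v
    rw [← factorial_mul_localDc] at h5
    have h6 := altSum_fderiv_mul_prod (x := y) (fun (_ : Fin (2 * N + 1) → E) => u) Ω (tangentI E)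
      0 (fun (i : Fin N) s => (pairIndex i s).succ)
      (fun i s i' s' h => by simp [pairIndex] at h; omega) (fun i s => Fin.succ_ne_zero _)
      (fun _ => h2.differentiableAt (by simp))
      ((contDiffAt_localDdc h1).differentiableAt (by simp)) (fun _ _ _ => rfl)
      (localDdc_cyclic_tangentI h1) v
    have hf : ((2 * N).factorial : ℝ) ≠ 0 := by positivity
    refine mul_left_cancel₀ hf ?_
    rw [← h6, mul_left_comm, h5]
    rfl
  -- The values of `d d^c ω^N`.
  have hddc : 2 ^ N * extDeriv (localDc fun y => wedgePow (η y) N) y₀ v =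
      altSum (fun w => fderiv ℝ (fderiv ℝ u) y₀ (w 0) (tangentI E (w 1)) *
        ∏ i : Fin N, Ω y₀ ![w (pairIndex i 0).succ.succ, w (pairIndex i 1).succ.succ]) v := by
    have h2 := hu_smooth.self_of_nhds
    have h2' : DifferentiableAt ℝ (fderiv ℝ u) y₀ :=
      (contDiffAt_fderiv_infty h2).differentiableAt (by simp)
    have h5 := altSum_fderiv_of_altSum
      ((contDiffAt_localDc hα_smooth.self_of_nhds).differentiableAt (by simp))
      (fun w z => fderiv ℝ u z (tangentI E (w 0)) *
        ∏ i : Fin N, Ω z ![w (pairIndex i 0).succ, w (pairIndex i 1).succ])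
      (fun w => (h2'.clm_apply (differentiableAt_const _)).mul (hprod y₀ hp₀ _)) hdc
      (ContinuousLinearMap.id ℝ E) v
    simp only [ContinuousLinearMap.id_apply] at h5
    rw [← factorial_mul_extDeriv] at h5
    have h6 := altSum_fderiv_mul_prod (x := y₀)
      (fun (w : Fin (2 * N + 1 + 1) → E) z => fderiv ℝ u z (tangentI E (w 1))) Ω
      (ContinuousLinearMap.id ℝ E) 0 (fun (i : Fin N) s => (pairIndex i s).succ.succ)
      (fun i s i' s' h => by simp [pairIndex] at h; omega) (fun i s => Fin.succ_ne_zero _)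
      (fun _ => h2'.clm_apply (differentiableAt_const _))
      ((contDiffAt_localDdc hp₀).differentiableAt (by simp))
      (fun w w' h => by
        rw [h 1 (by simp) fun i s h => by
          have := congrArg Fin.val h
          rw [Fin.val_one, Fin.val_succ, Fin.val_succ] at this
          omega])
      (localDdc_cyclic hp₀) v
    have hf : ((2 * N + 1).factorial : ℝ) ≠ 0 := by positivity
    refine mul_left_cancel₀ hf ?_
    simp only [ContinuousLinearMap.id_apply, fderiv_apply_const h2'] at h6
    rw [← h6, mul_left_comm, h5]
    rfl
  -- The second derivative of `u = p⁻ᴺ`.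
  have hu2 (a b : E) : fderiv ℝ (fderiv ℝ u) y₀ a b =
      N * (N + 1) * (p y₀ ^ (N + 2))⁻¹ * fderiv ℝ p y₀ a * fderiv ℝ p y₀ b -
        N * (p y₀ ^ (N + 1))⁻¹ * fderiv ℝ (fderiv ℝ p) y₀ a b := by
    have hpow (m : ℕ) (y : E) (h1 : ContDiffAt ℝ ∞ p y) (h2 : p y ≠ 0) :
        HasFDerivAt (fun y => (p y ^ m)⁻¹) (-(m * (p y ^ (m + 1))⁻¹) • fderiv ℝ p y) y := by
      have h3 := (hasDerivAt_zpow (-(m : ℤ)) (p y) (Or.inl h2)).comp_hasFDerivAt y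
        (h1.differentiableAt (by simp)).hasFDerivAt
      have e : ((-(m : ℤ) : ℤ) : ℝ) * p y ^ (-(m : ℤ) - 1) = -(m * (p y ^ (m + 1))⁻¹) := by
        rw [show (-(m : ℤ) - 1) = -((m + 1 : ℕ) : ℤ) by push_cast; ring, zpow_neg, zpow_natCast]
        push_cast
        ring
      rw [e] at h3
      refine h3.congr_of_eventuallyEq (Filter.Eventually.of_forall fun z => ?_)
      simp [zpow_neg]
    have h1 : fderiv ℝ u =ᶠ[𝓝 y₀] fun y => -(N * (p y ^ (N + 1))⁻¹) • fderiv ℝ p y := by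
      filter_upwards [hp, hne] with y h1 h2
      exact (hpow N y h1 h2).fderiv
    have h2 := (((hpow (N + 1) y₀ hp₀ hpos).const_mul (N : ℝ)).neg).smul
      ((contDiffAt_fderiv_infty hp₀).differentiableAt (by simp)).hasFDerivAt
    rw [h1.fderiv_eq]
    change fderiv ℝ ((-fun y => (N : ℝ) * (p y ^ (N + 1))⁻¹) • fderiv ℝ p) y₀ a b = _
    rw [h2.fderiv]
    simp [ContinuousLinearMap.smulRight_apply]
    ring
  rw [hddc]
  have hη₀ := hη.self_of_nhds
  -- Exchanging `w 0` and `w 1` turns the second derivative of `p` into half of `dd^c p`.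
  have hswap : altSum (fun w => fderiv ℝ (fderiv ℝ p) y₀ (w 0) (tangentI E (w 1)) *
      ∏ i : Fin N, Ω y₀ ![w (pairIndex i 0).succ.succ, w (pairIndex i 1).succ.succ]) v =
      altSum (fun w => (1 / 2 * Ω y₀ ![w 0, w 1]) *
        ∏ i : Fin N, Ω y₀ ![w (pairIndex i 0).succ.succ, w (pairIndex i 1).succ.succ]) v := by
    set f : (Fin (2 * N + 1 + 1) → E) → ℝ :=
      fun w => fderiv ℝ (fderiv ℝ p) y₀ (w 0) (tangentI E (w 1)) *
      ∏ i : Fin N, Ω y₀ ![w (pairIndex i 0).succ.succ, w (pairIndex i 1).succ.succ] with hf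
    have h1 := altSum_comp_perm f (Equiv.swap 0 1) v
    rw [Equiv.Perm.sign_swap (by simp)] at h1
    have h2 : (fun w : Fin (2 * N + 1 + 1) → E => (1 / 2 * Ω y₀ ![w 0, w 1]) *
        ∏ i : Fin N, Ω y₀ ![w (pairIndex i 0).succ.succ, w (pairIndex i 1).succ.succ]) =
        fun w => (1 / 2) * f w + (-(1 / 2)) * f (w ∘ Equiv.swap 0 1) := by
      ext w
      have h3 (j : Fin (2 * N)) : Equiv.swap (0 : Fin (2 * N + 1 + 1)) 1 j.succ.succ =
          j.succ.succ :=
        Equiv.swap_apply_of_ne_of_ne (by simp [Fin.ext_iff]) (by simp [Fin.ext_iff])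
      rw [hΩ, localDdc_apply (hp₀.of_le two_le_infty)]
      simp only [hf, Function.comp_apply, h3, Equiv.swap_apply_left, Equiv.swap_apply_right]
      ring
    rw [h2, altSum_add, altSum_const_mul, altSum_const_mul, h1]
    push_cast
    ring
  have hsplit (c₁ c₂ : ℝ) : altSum (fun w => (c₁ * fderiv ℝ p y₀ (w 0) *
      fderiv ℝ p y₀ (tangentI E (w 1)) - c₂ * fderiv ℝ (fderiv ℝ p) y₀ (w 0) (tangentI E (w 1))) *
      ∏ i : Fin N, Ω y₀ ![w (pairIndex i 0).succ.succ, w (pairIndex i 1).succ.succ]) v =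
      altSum (fun w => (c₁ * fderiv ℝ p y₀ (w 0) * fderiv ℝ p y₀ (tangentI E (w 1)) -
      c₂ * (1 / 2 * Ω y₀ ![w 0, w 1])) *
      ∏ i : Fin N, Ω y₀ ![w (pairIndex i 0).succ.succ, w (pairIndex i 1).succ.succ]) v := by
    simp only [sub_eq_add_neg, ← neg_mul, add_mul]
    rw [altSum_add, altSum_add]
    congr 1
    simp only [mul_assoc (-c₂)]
    rw [altSum_const_mul, altSum_const_mul, hswap]
  simp only [hu2]
  rw [hsplit, ← altSum_const_mul]
  congr 1
  ext w
  rw [hη₀]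
  simp only [ContinuousAlternatingMap.smul_apply, smul_eq_mul]
  rw [Finset.prod_mul_distrib, Finset.prod_const, Finset.card_univ, Fintype.card_fin, inv_pow]
  field_simp
  ring

end FlatComputation

/-! ### Hermitian linear algebra -/

section HermitianAlgebra

/-- For a Hermitian inner product `B` and a real functional `θ` there is a complex `B`-orthonormal
basis in which `θ` is a multiple of the real part of the first coordinate. -/
theorem exists_adapted_basis {V : Type*} [AddCommGroup V] [Module ℂ V] [Module ℝ V]
    [IsScalarTower ℝ ℂ V] [FiniteDimensional ℂ V] {N : ℕ} (hdim : Module.finrank ℂ V = N + 1)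
    (B : V →ₗ[ℝ] V →ₗ[ℝ] ℝ) (hsymm : ∀ v w, B v w = B w v) (hpos : ∀ v, v ≠ 0 → 0 < B v v)
    (hI : ∀ v w, B (Complex.I • v) (Complex.I • w) = B v w) (θ : V →ₗ[ℝ] ℝ) :
    ∃ (e : Module.Basis (Fin (N + 1)) ℂ V) (c : ℝ),
      (∀ i j, B (e i) (e j) = if i = j then 1 else 0) ∧
      (∀ i j, B (e i) (Complex.I • e j) = 0) ∧
      (∀ i, θ (e i) = if i = 0 then c else 0) ∧ (∀ i, θ (Complex.I • e i) = 0) ∧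
      ((∀ v, θ v ^ 2 + θ (Complex.I • v) ^ 2 ≤ B v v) ↔ c ^ 2 ≤ 1) := by
  have hsplit (z : ℂ) (v : V) : z • v = z.re • v + z.im • (Complex.I • v) := by
    have h (r : ℝ) (u : V) : r • u = (r : ℂ) • u := (algebraMap_smul ℂ r u).symm
    rw [h, h, smul_smul, ← add_smul, Complex.re_add_im]
  have hIr (r : ℝ) (v : V) : Complex.I • r • v = r • Complex.I • v := by
    have h (r : ℝ) (u : V) : r • u = (r : ℂ) • u := (algebraMap_smul ℂ r u).symm
    rw [h, h, smul_comm]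
  have hII (v : V) : Complex.I • Complex.I • v = -v := by
    rw [smul_smul, Complex.I_mul_I, neg_one_smul]
  have hI2 (v w : V) : B (Complex.I • v) w = -B v (Complex.I • w) := by
    have := hI v (-(Complex.I • w))
    rw [smul_neg, hII, neg_neg, map_neg] at this
    exact this
  -- The Hermitian inner product with real part `B`.
  let core : InnerProductSpace.Core ℂ V :=
    { inner := fun v w => ⟨B v w, -B v (Complex.I • w)⟩
      conj_inner_symm := fun x y => by
        apply Complex.ext
        · simp [hsymm]
        · simp [hsymm y, hI2]
      re_inner_nonneg := fun x => by
        by_cases h : x = 0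
        · simp [h]
        · exact (hpos x h).le
      add_left := fun x y z => by
        apply Complex.ext
        · simp
        · simp; ring
      smul_left := fun x y r => by
        rw [hsplit r x]
        apply Complex.ext
        · simp [hI2, sub_eq_add_neg]
        · simp [hI2, hII]; ring
      definite := fun x h => by
        by_contra hx
        exact (hpos x hx).ne' (congrArg Complex.re h) }
  let : NormedAddCommGroup V := core.toNormedAddCommGroup
  let : InnerProductSpace ℂ V := InnerProductSpace.ofCore core.toCore
  have hinner (v w : V) : inner ℂ v w = (⟨B v w, -B v (Complex.I • w)⟩ : ℂ) := rfl
  have : CompleteSpace V := FiniteDimensional.complete ℂ V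
  -- The complex linear functional with real part `θ`. The first basis vector is taken along the
  -- vector that represents it.
  let lam₀ : V →ₗ[ℂ] ℂ :=
    { toFun := fun v => ⟨θ v, -θ (Complex.I • v)⟩
      map_add' := fun v w => by
        apply Complex.ext
        · simp
        · simp; ring
      map_smul' := fun z v => by
        rw [hsplit z v]
        apply Complex.ext
        · simp
        · simp [hII, hIr]; ring }
  let lam : V →L[ℂ] ℂ := LinearMap.toContinuousLinearMap lam₀
  set a : V := (InnerProductSpace.toDual ℂ V).symm lam with ha_def
  have ha (v : V) : inner ℂ a v = (⟨θ v, -θ (Complex.I • v)⟩ : ℂ) :=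
    InnerProductSpace.toDual_symm_apply
  obtain ⟨e, he⟩ : ∃ e : OrthonormalBasis (Fin (N + 1)) ℂ V, a = (‖a‖ : ℂ) • e 0 := by
    by_cases h0 : a = 0
    · obtain ⟨e, -⟩ := Orthonormal.exists_orthonormalBasis_extension_of_card_eq (𝕜 := ℂ) (E := V)
        (ι := Fin (N + 1)) (by simp [hdim]) (v := fun _ => 0) (s := ∅)
        ⟨fun i => i.2.elim, fun i => i.2.elim⟩
      exact ⟨e, by simp [h0]⟩
    · have hn : ‖a‖ ≠ 0 := norm_ne_zero_iff.2 h0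
      obtain ⟨e, he⟩ := Orthonormal.exists_orthonormalBasis_extension_of_card_eq (𝕜 := ℂ) (E := V)
        (ι := Fin (N + 1)) (by simp [hdim]) (v := fun _ => ((‖a‖ : ℂ)⁻¹) • a) (s := {0})
        ⟨fun i => by simp [norm_smul, hn], fun i j hij =>
          (hij (Subtype.ext (i.2.trans j.2.symm))).elim⟩
      refine ⟨e, ?_⟩
      rw [he 0 rfl, smul_smul, mul_inv_cancel₀ (by exact_mod_cast hn), one_smul]
  have hθ (i : Fin (N + 1)) : (⟨θ (e i), -θ (Complex.I • e i)⟩ : ℂ) =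
      if i = 0 then (‖a‖ : ℂ) else 0 := by
    rw [← ha, he, inner_smul_left, OrthonormalBasis.inner_eq_ite, ← he]
    simp [eq_comm]
  have hB (i j : Fin (N + 1)) : (⟨B (e i) (e j), -B (e i) (Complex.I • e j)⟩ : ℂ) =
      if i = j then 1 else 0 := by
    rw [← hinner, OrthonormalBasis.inner_eq_ite]
  have hθ0 (i : Fin (N + 1)) : θ (e i) = if i = 0 then ‖a‖ else 0 := by
    have := congrArg Complex.re (hθ i)
    split_ifs at this ⊢ <;> simpa using this
  have hB1 (i j : Fin (N + 1)) : B (e i) (e j) = if i = j then 1 else 0 := by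
    have := congrArg Complex.re (hB i j)
    split_ifs at this ⊢ <;> simpa using this
  have hθ1 (i : Fin (N + 1)) : θ (Complex.I • e i) = 0 := by
    have := congrArg Complex.im (hθ i)
    split_ifs at this <;> simpa using this
  refine ⟨e.toBasis, ‖a‖, by simpa using hB1, fun i j => ?_, by simpa using hθ0,
    by simpa using hθ1, fun h => ?_, fun h v => ?_⟩
  · have := congrArg Complex.im (hB i j)
    simp only [OrthonormalBasis.coe_toBasis]
    split_ifs at this <;> simpa using this
  · have := h (e 0)
    rw [hθ0, hθ1, hB1] at this
    simpa using this
  · have h1 := norm_inner_le_norm (𝕜 := ℂ) a v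
    have h2 : ‖a‖ ≤ 1 := by nlinarith [norm_nonneg a]
    have h3 : ‖(inner ℂ a v : ℂ)‖ ≤ ‖v‖ := h1.trans (by nlinarith [norm_nonneg v])
    have h4 : ‖(inner ℂ a v : ℂ)‖ ^ 2 ≤ ‖v‖ ^ 2 := by gcongr
    have h5 : ‖v‖ ^ 2 = B v v := by
      rw [← inner_self_eq_norm_sq (𝕜 := ℂ), hinner]
      rfl
    rw [h5, ha, Complex.sq_norm, Complex.normSq_apply] at h4
    simp only at h4
    nlinarith

/-- An alternating sum over the permutations of `n` pairs of a product of functions of the pairs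
that vanish off the pairs `((j, s), (j, t))` reduces to a sum over the permutations of `n`
letters. -/
theorem sum_perm_prod_pairs {n : ℕ} (M : Fin n → Fin n × Fin 2 → Fin n × Fin 2 → ℝ)
    (hM : ∀ i p q, p.1 ≠ q.1 → M i p q = 0) :
    ∑ σ : Equiv.Perm (Fin n × Fin 2), ((Equiv.Perm.sign σ : ℤ) : ℝ) *
        ∏ i, M i (σ (i, 0)) (σ (i, 1)) =
      ∑ π : Equiv.Perm (Fin n), ∏ i, (M i (π i, 0) (π i, 1) - M i (π i, 1) (π i, 0)) := by
  -- Only the permutations that map pairs to pairs contribute: a permutation `x.1` of the pairs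
  -- followed by permutations inside the pairs.
  let emb : Equiv.Perm (Fin n) × (Fin n → Equiv.Perm (Fin 2)) → Equiv.Perm (Fin n × Fin 2) :=
    fun x => Equiv.prodCongrLeft (fun _ => x.1) * Equiv.prodCongrRight x.2
  have hemb (x) (p : Fin n × Fin 2) : emb x p = (x.1 p.1, x.2 p.1 p.2) := rfl
  have hinj : Function.Injective emb := by
    intro x y hxy
    have h1 (p : Fin n × Fin 2) : (x.1 p.1, x.2 p.1 p.2) = (y.1 p.1, y.2 p.1 p.2) := by
      rw [← hemb, ← hemb, hxy]
    refine Prod.ext (Equiv.ext fun i => ?_) (funext fun i => Equiv.ext fun s => ?_)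
    · exact congrArg Prod.fst (h1 (i, 0))
    · exact congrArg Prod.snd (h1 (i, s))
  have hsum2 (f : Equiv.Perm (Fin 2) → ℝ) : ∑ τ, f τ = f 1 + f (Equiv.swap 0 1) := by
    have : (Finset.univ : Finset (Equiv.Perm (Fin 2))) = {1, Equiv.swap 0 1} := by decide
    rw [this, Finset.sum_pair (by decide)]
  have hright (π : Equiv.Perm (Fin n)) :
      ∏ i, (M i (π i, 0) (π i, 1) - M i (π i, 1) (π i, 0)) =
      ∑ t : Fin n → Equiv.Perm (Fin 2), ∏ i, (((Equiv.Perm.sign (t i) : ℤ) : ℝ) *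
        M i (π i, t i 0) (π i, t i 1)) := by
    rw [← Fintype.prod_sum fun i (τ : Equiv.Perm (Fin 2)) => ((Equiv.Perm.sign τ : ℤ) : ℝ) *
        M i (π i, τ 0) (π i, τ 1)]
    refine Finset.prod_congr rfl fun i _ => ?_
    rw [hsum2]
    simp [sub_eq_add_neg]
  simp only [hright]
  rw [← Fintype.sum_prod_type']
  symm
  refine Fintype.sum_of_injective emb hinj _ _ (fun σ hσ => ?_) fun x => ?_
  · by_contra hne
    have hne' : ∀ i, (σ (i, 0)).1 = (σ (i, 1)).1 := by
      intro i
      by_contra h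
      exact hne (by rw [Finset.prod_eq_zero (Finset.mem_univ i) (hM i _ _ h), mul_zero])
    have hfst (i : Fin n) (s : Fin 2) : (σ (i, s)).1 = (σ (i, 0)).1 := by
      fin_cases s
      · rfl
      · exact (hne' i).symm
    have htinj (i : Fin n) : Function.Injective fun s => (σ (i, s)).2 := by
      intro s s' h
      have : σ (i, s) = σ (i, s') := Prod.ext ((hfst i s).trans (hfst i s').symm) h
      exact congrArg Prod.snd (σ.injective this)
    let t (i : Fin n) : Equiv.Perm (Fin 2) :=
      Equiv.ofBijective _ (Finite.injective_iff_bijective.1 (htinj i))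
    have hπinj : Function.Injective fun i => (σ (i, 0)).1 := by
      intro i i' h
      obtain ⟨s, hs⟩ := (t i).surjective (σ (i', 0)).2
      have : σ (i, s) = σ (i', 0) := Prod.ext ((hfst i s).trans h) hs
      exact congrArg Prod.fst (σ.injective this)
    refine hσ ⟨(Equiv.ofBijective _ (Finite.injective_iff_bijective.1 hπinj), t), ?_⟩
    ext1 p
    rw [hemb]
    exact Prod.ext (hfst p.1 p.2).symm rfl
  · have hsign : Equiv.Perm.sign (emb x) = ∏ i, Equiv.Perm.sign (x.2 i) := by
      simp only [emb]
      rw [map_mul]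
      have h1 := Equiv.Perm.sign_prodCongrLeft (β := Fin n) fun _ : Fin 2 => x.1
      have h2 := Equiv.Perm.sign_prodCongrRight x.2
      rw [h1, h2, Fin.prod_univ_two, Int.units_mul_self, one_mul]
    rw [hsign, Finset.prod_mul_distrib]
    simp only [hemb]
    push_cast
    rfl

theorem sum_perm_apply_zero (N : ℕ) :
    ∑ π : Equiv.Perm (Fin (N + 1)), (if π 0 = 0 then (1 : ℝ) else 0) = N.factorial := by
  rw [← Equiv.sum_comp Equiv.Perm.decomposeFin.symm, Fintype.sum_prod_type]
  simp [Fintype.card_perm]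

end HermitianAlgebra

section RealBasis

variable {E : Type*} [NormedAddCommGroup E] [NormedSpace ℂ E]

/-- The indices `0, …, 2 N + 1` arranged in pairs `(2 i, 2 i + 1)`. -/
def pairEquiv (N : ℕ) : Fin (N + 1) × Fin 2 ≃ Fin (2 * N + 1 + 1) :=
  finProdFinEquiv.trans (finCongr (by ring))

/-- The real basis `e₀, i e₀, e₁, i e₁, …` that underlies a complex basis `e`. -/
noncomputable def realBasis {N : ℕ} (e : Module.Basis (Fin (N + 1)) ℂ E) :
    Module.Basis (Fin (2 * N + 1 + 1)) ℝ E :=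
  (Complex.basisOneI.smulTower e).reindex ((Equiv.prodComm _ _).trans (pairEquiv N))

theorem realBasis_pairEquiv {N : ℕ} (e : Module.Basis (Fin (N + 1)) ℂ E) (i : Fin (N + 1))
    (s : Fin 2) : realBasis e (pairEquiv N (i, s)) = Complex.basisOneI s • e i := by
  simp [realBasis, Module.Basis.smulTower_apply]

/-- A complex linear map acts on real forms of top degree by the square of the modulus of its
determinant; in particular, complex linear isomorphisms preserve the orientation. -/
theorem map_comp_complexLinear [FiniteDimensional ℂ E] {ι : Type*} [Fintype ι] [DecidableEq ι]
    (K : E [⋀^ι]→L[ℝ] ℝ) (b : Module.Basis ι ℝ E) (f : E →ₗ[ℂ] E) :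
    K (f ∘ b) = Complex.normSq (LinearMap.det f) * K b := by
  have h1 := congrArg (fun A : E [⋀^ι]→ₗ[ℝ] ℝ => A (f.restrictScalars ℝ ∘ b))
    (K.toAlternatingMap.eq_smul_basis_det b)
  simp only [AlternatingMap.smul_apply, smul_eq_mul] at h1
  rw [b.det_comp, b.det_self, mul_one, LinearMap.det_restrictScalars,
    Algebra.norm_complex_apply] at h1
  rw [mul_comm]
  exact h1

theorem exists_pos_map_realBasis {N : ℕ} (e e' : Module.Basis (Fin (N + 1)) ℂ E) :
    ∃ r : ℝ, 0 < r ∧ ∀ K : E [⋀^Fin (2 * N + 1 + 1)]→L[ℝ] ℝ,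
      K (realBasis e') = r * K (realBasis e) := by
  have : FiniteDimensional ℂ E := e.finiteDimensional_of_finite
  let f : E ≃ₗ[ℂ] E := e.equiv e' (Equiv.refl _)
  refine ⟨Complex.normSq (LinearMap.det f.toLinearMap),
    Complex.normSq_pos.2 (LinearEquiv.isUnit_det' f).ne_zero, fun K => ?_⟩
  rw [← map_comp_complexLinear]
  congr 1
  ext k
  obtain ⟨⟨i, s⟩, rfl⟩ := (pairEquiv N).surjective k
  simp only [Function.comp_apply, realBasis_pairEquiv]
  rw [LinearEquiv.coe_coe, map_smul]
  simp [f]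

theorem tangentI_apply (v : E) : tangentI E v = Complex.I • v := rfl

/-- The value on a suitable complex basis of the top form that computes `d d^c ω^N`, for
`ω = B(·, I·)`: it has the sign of `1 - |θ|²` up to the factor `(-1)^N`. -/
theorem exists_basis_altSum_eq [FiniteDimensional ℂ E] {N : ℕ}
    (hdim : Module.finrank ℂ E = N + 1) (B : E →L[ℝ] E →L[ℝ] ℝ)
    (hsymm : ∀ v w, B v w = B w v) (hpos : ∀ v, v ≠ 0 → 0 < B v v)
    (hI : ∀ v w, B (tangentI E v) (tangentI E w) = B v w) (θ : E →L[ℝ] ℝ) :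
    ∃ (e : Module.Basis (Fin (N + 1)) ℂ E) (s : ℝ),
      ((∀ v, θ v ^ 2 + θ (tangentI E v) ^ 2 ≤ B v v) ↔ 0 ≤ s) ∧
      altSum (fun w => (-(1 / 2) * B (w 0) (tangentI E (w 1)) +
        (N + 1) * θ (w 0) * θ (tangentI E (w 1))) *
          ∏ i : Fin N, B (w (pairIndex i 0).succ.succ) (tangentI E (w (pairIndex i 1).succ.succ)))
        (realBasis e) = (-2) ^ N * (N + 1).factorial * s := by
  obtain ⟨e, c, h1, h2, h3, h4, h5⟩ := exists_adapted_basis hdim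
    ((ContinuousLinearMap.coeLM ℝ).comp B.toLinearMap) hsymm hpos hI θ.toLinearMap
  refine ⟨e, 1 - c ^ 2, h5.trans sub_nonneg.symm, ?_⟩
  set u : Fin (N + 1) × Fin 2 → E := fun p => Complex.basisOneI p.2 • e p.1 with hu
  set b₀ : E → E → ℝ := fun v w => -(1 / 2) * B v (tangentI E w) +
    (N + 1) * θ v * θ (tangentI E w) with hb₀
  set b₁ : E → E → ℝ := fun v w => B v (tangentI E w) with hb₁
  obtain ⟨Mf, hM0, hMs⟩ : ∃ Mf : Fin (N + 1) → E → E → ℝ, Mf 0 = b₀ ∧ ∀ i : Fin N, Mf i.succ = b₁ :=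
    ⟨Fin.cons b₀ fun _ => b₁, rfl, fun _ => rfl⟩
  have hre : realBasis e ∘ pairEquiv N = u := by
    ext ⟨i, s⟩
    exact realBasis_pairEquiv e i s
  have hidx (i : Fin N) (s : Fin 2) : (pairIndex i s).succ.succ = pairEquiv N (i.succ, s) := by
    ext
    simp [pairEquiv, pairIndex]
    ring
  have hidx0 : (0 : Fin (2 * N + 1 + 1)) = pairEquiv N (0, 0) := by
    ext; simp [pairEquiv]
  have hidx1 : (1 : Fin (2 * N + 1 + 1)) = pairEquiv N (0, 1) := by
    ext; simp [pairEquiv]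
  have hform : (fun w : Fin (2 * N + 1 + 1) → E => b₀ (w 0) (w 1) *
      ∏ i : Fin N, b₁ (w (pairIndex i 0).succ.succ) (w (pairIndex i 1).succ.succ)) =
      fun w => (fun w' : Fin (N + 1) × Fin 2 → E =>
        ∏ i, Mf i (w' (i, 0)) (w' (i, 1)))
          (w ∘ pairEquiv N) := by
    ext w
    simp only [Fin.prod_univ_succ, hM0, hMs, hidx, hidx0, hidx1,
      Function.comp_apply]
  change altSum (fun w : Fin (2 * N + 1 + 1) → E => b₀ (w 0) (w 1) *
      ∏ i : Fin N, b₁ (w (pairIndex i 0).succ.succ) (w (pairIndex i 1).succ.succ))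
        (realBasis e) = _
  rw [hform, altSum_comp_equiv (pairEquiv N) (fun w' : Fin (N + 1) × Fin 2 → E =>
    ∏ i, Mf i (w' (i, 0)) (w' (i, 1))), hre]
  have h1' (i j) : B (e i) (e j) = if i = j then 1 else 0 := h1 i j
  have h2' (i j) : B (e i) (Complex.I • e j) = 0 := h2 i j
  have h3' (i) : θ (e i) = if i = 0 then c else 0 := h3 i
  have h4' (i) : θ (Complex.I • e i) = 0 := h4 i
  have hI' (v w : E) : B (Complex.I • v) (Complex.I • w) = B v w := hI v w
  have hII (v : E) : Complex.I • Complex.I • v = -v := by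
    rw [smul_smul, Complex.I_mul_I, neg_one_smul]
  have hu0 (i) : u (i, 0) = e i := by simp [hu]
  have hu1 (i) : u (i, 1) = Complex.I • e i := by simp [hu]
  have h2'' (i j) : B (Complex.I • e i) (e j) = 0 := by rw [hsymm, h2']
  have hb₁0 (j k : Fin (N + 1)) (s t : Fin 2) (hjk : j ≠ k) : b₁ (u (j, s)) (u (k, t)) = 0 := by
    match s, t with
    | 0, 0 => simp only [hb₁, hu0, tangentI_apply, h2']
    | 0, 1 => simp only [hb₁, hu0, hu1, tangentI_apply, hII, map_neg, h1', if_neg hjk, neg_zero]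
    | 1, 0 => simp only [hb₁, hu0, hu1, tangentI_apply, hI', h1', if_neg hjk]
    | 1, 1 => simp only [hb₁, hu1, tangentI_apply, hII, map_neg, h2'', neg_zero]
  have hθ0 (j k : Fin (N + 1)) (s t : Fin 2) (hjk : j ≠ k) :
      θ (u (j, s)) * θ (tangentI E (u (k, t))) = 0 := by
    match s, t with
    | 0, 0 => simp only [hu0, tangentI_apply, h4', mul_zero]
    | 0, 1 =>
      simp only [hu0, hu1, tangentI_apply, hII, map_neg, h3']
      split_ifs with ha hb
      · exact absurd (ha.trans hb.symm) hjk
      all_goals simp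
    | 1, t => simp only [hu1, h4', zero_mul]
  have hsum := sum_perm_prod_pairs (fun i p q => Mf i (u p) (u q)) (by
    rintro i ⟨j, s⟩ ⟨k, t⟩ hjk
    refine Fin.cases ?_ (fun i => ?_) i
    · rw [hM0]
      have h6 := hb₁0 j k s t hjk
      simp only [hb₁] at h6
      simp only [hb₀]
      rw [h6, mul_assoc, hθ0 j k s t hjk]
      ring
    · rw [hMs, hb₁0 j k s t hjk])
  refine Eq.trans ?_ (hsum.trans ?_)
  · rfl
  · have hprod (π : Equiv.Perm (Fin (N + 1))) :
        ∏ i, (Mf i (u (π i, 0)) (u (π i, 1)) -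
          Mf i (u (π i, 1)) (u (π i, 0))) =
        (-2) ^ N - (-2) ^ N * ((N + 1) * c ^ 2) * (if π 0 = 0 then 1 else 0) := by
      rw [Fin.prod_univ_succ]
      simp only [hM0, hMs, hu0, hu1, hb₀, hb₁, tangentI_apply, h1', h3',
        h4', hI', hII, map_neg, if_true]
      rw [Finset.prod_const, Finset.card_univ, Fintype.card_fin]
      split_ifs <;> ring
    simp only [hprod]
    rw [Finset.sum_sub_distrib, ← Finset.mul_sum, sum_perm_apply_zero, Finset.sum_const,
      Finset.card_univ, Fintype.card_perm, Fintype.card_fin, nsmul_eq_mul, Nat.factorial_succ]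
    push_cast
    ring

end RealBasis

/-! ### Holomorphic maps and natural differential operators -/

section Holomorphic

variable {E : Type*} [NormedAddCommGroup E] [NormedSpace ℂ E]
variable {F : Type*} [NormedAddCommGroup F] [NormedSpace ℝ F]

theorem fderiv_real_eq_restrictScalars {τ : E → E} {y : E} (hτ : ContDiffAt ℂ ω τ y) :
    fderiv ℝ τ y = (fderiv ℂ τ y).restrictScalars ℝ :=
  (hτ.differentiableAt (by simp)).fderiv_restrictScalars ℝ

theorem fderiv_tangentI {τ : E → E} {y : E} (hτ : ContDiffAt ℂ ω τ y) (v : E) :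
    fderiv ℝ τ y (tangentI E v) = tangentI E (fderiv ℝ τ y v) := by
  rw [fderiv_real_eq_restrictScalars hτ]
  exact (fderiv ℂ τ y).map_smul Complex.I v

theorem fderiv_fderiv_tangentI {τ : E → E} {y : E} (hτ : ContDiffAt ℂ ω τ y) (v w : E) :
    fderiv ℝ (fderiv ℝ τ) y v (tangentI E w) = tangentI E (fderiv ℝ (fderiv ℝ τ) y v w) := by
  have h2 : DifferentiableAt ℝ (fderiv ℝ τ) y :=
    ((hτ.restrict_scalars ℝ).fderiv_right (m := 1) (by simp)).differentiableAt (by simp)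
  have h3 : (fun z => fderiv ℝ τ z (tangentI E w)) =ᶠ[𝓝 y] fun z => tangentI E (fderiv ℝ τ z w) :=
    (hτ.eventually (by simp)).mono fun z hz => fderiv_tangentI hz w
  rw [← fderiv_apply_const h2, h3.fderiv_eq]
  have h4 := (tangentI E).hasFDerivAt.comp y
    (h2.clm_apply (differentiableAt_const w)).hasFDerivAt
  rw [← fderiv_apply_const h2]
  exact congrArg (fun A : E →L[ℝ] E => A v) h4.fderiv

/-- The operator `d^c` commutes with the pull-back along holomorphic maps. -/
theorem localDc_pullback {k : ℕ} {β : E → E [⋀^Fin k]→L[ℝ] F} {τ : E → E} {y : E}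
    (hβ : DifferentiableAt ℝ β (τ y)) (hτ : ContDiffAt ℂ ω τ y) :
    localDc (fun z => (β (τ z)).compContinuousLinearMap (fderiv ℝ τ z)) y =
      (localDc β (τ y)).compContinuousLinearMap (fderiv ℝ τ y) := by
  have hτ' : ContDiffAt ℝ ω τ y := hτ.restrict_scalars ℝ
  have h1 : DifferentiableAt ℝ τ y := hτ'.differentiableAt (by simp)
  have h2 : DifferentiableAt ℝ (fderiv ℝ τ) y :=
    (hτ'.fderiv_right (m := 1) (by simp)).differentiableAt (by simp)
  have hs (v w : E) : fderiv ℝ (fderiv ℝ τ) y v w = fderiv ℝ (fderiv ℝ τ) y w v :=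
    hτ'.isSymmSndFDerivAt (by simp) v w
  -- The second derivative of a holomorphic map is complex bilinear, hence still symmetric after
  -- composition with the complex structure.
  have hs' (v w : E) : (fderiv ℝ (fderiv ℝ τ) y).comp (tangentI E) v w =
      (fderiv ℝ (fderiv ℝ τ) y).comp (tangentI E) w v := by
    simp only [ContinuousLinearMap.comp_apply]
    rw [hs, fderiv_fderiv_tangentI hτ, hs w v, ← fderiv_fderiv_tangentI hτ, hs]
  have hβτ : DifferentiableAt ℝ (fun z => β (τ z)) y := hβ.comp y h1
  rw [localDc, fderiv_continuousAlternatingMapCompContinuousLinearMap hβτ h2,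
    ContinuousLinearMap.add_comp, ContinuousAlternatingMap.alternatizeUncurryFin_add,
    ContinuousLinearMap.comp_assoc _ (fderiv ℝ (fderiv ℝ τ) y),
    ContinuousAlternatingMap.alternatizeUncurryFin_fderivCompContinuousLinearMap_eq_zero _ _ hs',
    add_zero, fderiv_fun_comp y hβ h1, localDc]
  ext v
  simp +unfoldPartialApp [ContinuousAlternatingMap.alternatizeUncurryFin_apply, Fin.removeNth,
    Function.comp_def, fderiv_tangentI hτ]

/-- A differential operator on forms that depends only on the germ of the form and commutes with
pull-backs along holomorphic maps. -/
structure IsNaturalOperator {k l : ℕ}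
    (D : (E → E [⋀^Fin k]→L[ℝ] F) → E → E [⋀^Fin l]→L[ℝ] F) : Prop where
  congr : ∀ α β y, α =ᶠ[𝓝 y] β → D α y = D β y
  pullback : ∀ (τ : E → E) (β : E → E [⋀^Fin k]→L[ℝ] F) (y : E), ContDiffAt ℂ ω τ y →
    DifferentiableAt ℝ β (τ y) →
    D (fun z => (β (τ z)).compContinuousLinearMap (fderiv ℝ τ z)) y =
      (D β (τ y)).compContinuousLinearMap (fderiv ℝ τ y)
  smooth : ∀ β y, ContDiffAt ℝ ∞ β y → ContDiffAt ℝ ∞ (D β) y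

theorem isNaturalOperator_extDeriv {k : ℕ} :
    IsNaturalOperator (extDeriv : (E → E [⋀^Fin k]→L[ℝ] F) → _) where
  congr _ _ _ h := h.extDeriv_eq
  pullback _ _ _ hτ hβ := extDeriv_pullback hβ (hτ.restrict_scalars ℝ) (by simp)
  smooth _ _ h := contDiffAt_extDeriv h

theorem isNaturalOperator_localDc {k : ℕ} :
    IsNaturalOperator (localDc : (E → E [⋀^Fin k]→L[ℝ] F) → _) where
  congr _ _ _ h := h.localDc.self_of_nhds
  pullback _ _ _ hτ hβ := localDc_pullback hβ hτ
  smooth _ _ h := contDiffAt_localDc h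

variable {M : Type*} [TopologicalSpace M] [ChartedSpace E M]
variable {N : Type*} [TopologicalSpace N] [ChartedSpace E N]

theorem ContMDiffAt.mdifferentiableAt_real {f : N → M} {x : N}
    (hf : ContMDiffAt 𝓘(ℂ, E) 𝓘(ℂ, E) ω f x) : MDifferentiableAt 𝓘(ℝ, E) 𝓘(ℝ, E) f x := by
  rw [mdifferentiableAt_iff]
  exact ⟨hf.continuousAt,
    ((contMDiffAt_iff.1 hf).2.differentiableWithinAt (by simp)).restrictScalars ℝ⟩

theorem tangentMapAt_eq_fderiv (τ : E → E) (y : E) : tangentMapAt τ y = fderiv ℝ τ y :=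
  mfderiv_eq_fderiv

theorem tangentMapAt_congr {f f' : N → M} {x : N} (h : f =ᶠ[𝓝 x] f') :
    (tangentMapAt f x : E →L[ℝ] E) = tangentMapAt f' x :=
  h.mfderiv_eq

theorem isSmooth_iff_contDiffAt {k : ℕ} {α : DForm E M k F} : α.IsSmooth ↔
    ∀ φ ∈ atlas E M, ∀ y ∈ φ.target, ContDiffAt ℝ ∞ (α.inChart φ) y :=
  forall₂_congr fun φ _ => ⟨fun h _ hy => h.contDiffAt (φ.open_target.mem_nhds hy),
    fun h y hy => (h y hy).contDiffWithinAt⟩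

theorem exists_tangentMapAt_eq_restrictScalars {f : N → M} {x : N}
    (hf : ContMDiffAt 𝓘(ℂ, E) 𝓘(ℂ, E) ω f x) :
    ∃ L : E →L[ℂ] E, (tangentMapAt f x : E →L[ℝ] E) = L.restrictScalars ℝ := by
  have h1 := hf.mdifferentiableAt_real
  have h2 := (contMDiffAt_iff.1 hf).2
  simp only [modelWithCornersSelf_coe, Set.range_id, contDiffWithinAt_univ] at h2
  have h3 : (tangentMapAt f x : E →L[ℝ] E) =
      fderiv ℝ (extChartAt 𝓘(ℂ, E) (f x) ∘ f ∘ (extChartAt 𝓘(ℂ, E) x).symm)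
        (extChartAt 𝓘(ℂ, E) x x) := by
    have h4 := h1.mfderiv
    rw [modelWithCornersSelf_coe, Set.range_id, fderivWithin_univ] at h4
    exact h4
  exact ⟨_, h3.trans (fderiv_real_eq_restrictScalars h2)⟩

theorem tangentMapAt_tangentI {f : N → M} {x : N}
    (hf : ContMDiffAt 𝓘(ℂ, E) 𝓘(ℂ, E) ω f x) (v : E) :
    tangentMapAt f x (tangentI E v) = tangentI E (tangentMapAt f x v) := by
  obtain ⟨L, hL⟩ := exists_tangentMapAt_eq_restrictScalars hf
  rw [hL]
  exact L.map_smul Complex.I v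

theorem tangentMapAt_comp {N' : Type*} [TopologicalSpace N'] [ChartedSpace E N']
    {f : N → M} {r : N' → N} {x : N'}
    (hf : ContMDiffAt 𝓘(ℂ, E) 𝓘(ℂ, E) ω f (r x)) (hr : ContMDiffAt 𝓘(ℂ, E) 𝓘(ℂ, E) ω r x) :
    (tangentMapAt (f ∘ r) x : E →L[ℝ] E) = (tangentMapAt f (r x)).comp (tangentMapAt r x) :=
  mfderiv_comp x hf.mdifferentiableAt_real hr.mdifferentiableAt_real

variable [IsManifold 𝓘(ℂ, E) ω M]

theorem contMDiffAt_chart {φ : OpenPartialHomeomorph M E} (hφ : φ ∈ atlas E M) {x : M}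
    (hx : x ∈ φ.source) : ContMDiffAt 𝓘(ℂ, E) 𝓘(ℂ, E) ω φ x :=
  contMDiffAt_of_mem_maximalAtlas (IsManifold.subset_maximalAtlas hφ) hx

theorem contMDiffAt_chart_symm {φ : OpenPartialHomeomorph M E} (hφ : φ ∈ atlas E M) {y : E}
    (hy : y ∈ φ.target) : ContMDiffAt 𝓘(ℂ, E) 𝓘(ℂ, E) ω φ.symm y :=
  (contMDiffOn_symm_of_mem_maximalAtlas (IsManifold.subset_maximalAtlas hφ)).contMDiffAt
    (φ.open_target.mem_nhds hy)

theorem contDiffAt_chart_comp {φ : OpenPartialHomeomorph M E} (hφ : φ ∈ atlas E M) {r : E → M}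
    {y : E} (hr : ContMDiffAt 𝓘(ℂ, E) 𝓘(ℂ, E) ω r y) (hy : r y ∈ φ.source) :
    ContDiffAt ℂ ω (φ ∘ r) y :=
  contMDiffAt_iff_contDiffAt.1 ((contMDiffAt_chart hφ hy).comp y hr)

/-- The pull-back of a form along a holomorphic map, in terms of the expression of the form in a
chart. -/
theorem pullback_eq_inChart {k : ℕ} {φ : OpenPartialHomeomorph M E} (hφ : φ ∈ atlas E M)
    (α : DForm E M k F) {r : E → M} {y : E} (hr : ContMDiffAt 𝓘(ℂ, E) 𝓘(ℂ, E) ω r y)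
    (hy : r y ∈ φ.source) :
    DForm.pullback r α y =
      (α.inChart φ (φ (r y))).compContinuousLinearMap (fderiv ℝ (φ ∘ r) y) := by
  have h1 : r =ᶠ[𝓝 y] φ.symm ∘ (φ ∘ r) :=
    (hr.continuousAt.eventually (φ.open_source.mem_nhds hy)).mono fun z hz => (φ.left_inv hz).symm
  have h2 : (tangentMapAt r y : E →L[ℝ] E) =
      (tangentMapAt φ.symm (φ (r y))).comp (fderiv ℝ (φ ∘ r) y) := by
    rw [tangentMapAt_congr h1, tangentMapAt_comp (f := φ.symm) (r := φ ∘ r)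
      (contMDiffAt_chart_symm hφ (φ.map_source hy))
      (contMDiffAt_iff_contDiffAt.2 (contDiffAt_chart_comp hφ hr hy)), tangentMapAt_eq_fderiv]
    rfl
  rw [DForm.inChart, DForm.pullback, DForm.pullback, h2, φ.left_inv hy]
  rfl

theorem eventually_contMDiffAt {r : E → M} {y : E} (hr : ContMDiffAt 𝓘(ℂ, E) 𝓘(ℂ, E) ω r y) :
    ∀ᶠ z in 𝓝 y, ContMDiffAt 𝓘(ℂ, E) 𝓘(ℂ, E) ω r z := by
  have hφ := chart_mem_atlas E (r y)
  have hy := mem_chart_source E (r y)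
  have hsrc : ∀ᶠ z in 𝓝 y, r z ∈ (chartAt E (r y)).source :=
    hr.continuousAt.eventually ((chartAt E (r y)).open_source.mem_nhds hy)
  filter_upwards [(contDiffAt_chart_comp hφ hr hy).eventually (by simp), hsrc.eventually_nhds]
    with z hz hz'
  have h1 : r =ᶠ[𝓝 z] (chartAt E (r y)).symm ∘ (chartAt E (r y) ∘ r) :=
    hz'.mono fun z' h => ((chartAt E (r y)).left_inv h).symm
  refine ContMDiffAt.congr_of_eventuallyEq ?_ h1
  exact (contMDiffAt_chart_symm hφ ((chartAt E (r y)).map_source hz'.self_of_nhds)).comp z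
    (contMDiffAt_iff_contDiffAt.2 hz)

/-- Operators on forms that are defined in the preferred charts by a natural operator commute with
pull-backs along holomorphic maps from the model space. -/
theorem pullback_viaChart {k l : ℕ} {D : (E → E [⋀^Fin k]→L[ℝ] F) → E → E [⋀^Fin l]→L[ℝ] F}
    (hD : IsNaturalOperator D) (α : DForm E M k F) {r : E → M} {y : E}
    (hr : ContMDiffAt 𝓘(ℂ, E) 𝓘(ℂ, E) ω r y)
    (hα : DifferentiableAt ℝ (α.inChart (chartAt E (r y))) (chartAt E (r y) (r y))) :
    DForm.pullback r (α.viaChart D) y = D (DForm.pullback r α) y := by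
  have hφ := chart_mem_atlas E (r y)
  have hy := mem_chart_source E (r y)
  have h1 : DForm.pullback r α =ᶠ[𝓝 y] fun z => (α.inChart (chartAt E (r y))
      ((chartAt E (r y) ∘ r) z)).compContinuousLinearMap (fderiv ℝ (chartAt E (r y) ∘ r) z) := by
    filter_upwards [eventually_contMDiffAt hr,
      hr.continuousAt.eventually ((chartAt E (r y)).open_source.mem_nhds hy)] with z hz hz'
    exact pullback_eq_inChart hφ α hz hz'
  rw [hD.congr _ _ _ h1, hD.pullback _ _ _ (contDiffAt_chart_comp hφ hr hy) hα,
    ← tangentMapAt_eq_fderiv, tangentMapAt_comp (contMDiffAt_chart hφ hy) hr]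
  rfl

theorem viaChart_inChart {k l : ℕ} {D : (E → E [⋀^Fin k]→L[ℝ] F) → E → E [⋀^Fin l]→L[ℝ] F}
    (hD : IsNaturalOperator D) {α : DForm E M k F} (hα : α.IsSmooth)
    {φ : OpenPartialHomeomorph M E} (hφ : φ ∈ atlas E M) {y : E} (hy : y ∈ φ.target) :
    (α.viaChart D).inChart φ y = D (α.inChart φ) y := by
  refine pullback_viaChart hD α (contMDiffAt_chart_symm hφ hy) ?_
  set c := chartAt E (φ.symm y)
  exact ((hα c (chart_mem_atlas E _)).contDiffAt (c.open_target.mem_nhds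
    (c.map_source (mem_chart_source E _)))).differentiableAt (by simp)

theorem DForm.IsSmooth.viaChart {k l : ℕ}
    {D : (E → E [⋀^Fin k]→L[ℝ] F) → E → E [⋀^Fin l]→L[ℝ] F}
    (hD : IsNaturalOperator D) {α : DForm E M k F} (hα : α.IsSmooth) :
    (α.viaChart D).IsSmooth := by
  rw [isSmooth_iff_contDiffAt] at *
  intro φ hφ y hy
  refine (hD.smooth _ _ (hα φ hφ y hy)).congr_of_eventuallyEq ?_
  filter_upwards [φ.open_target.mem_nhds hy] with z hz
  exact viaChart_inChart hD (isSmooth_iff_contDiffAt.2 hα) hφ hz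

theorem tangentMapAt_chartAt_symm (x : M) :
    (tangentMapAt (chartAt E x).symm (chartAt E x x) : E →L[ℝ] E) = ContinuousLinearMap.id ℝ E := by
  have h := mfderivWithin_range_extChartAt_symm (I := 𝓘(ℝ, E)) (x := x)
  rw [modelWithCornersSelf_coe, Set.range_id, mfderivWithin_univ] at h
  exact h

theorem inChart_chartAt_self {k : ℕ} (α : DForm E M k F) (x : M) :
    α.inChart (chartAt E x) (chartAt E x x) = α x := by
  rw [DForm.inChart, DForm.pullback, tangentMapAt_chartAt_symm,
    (chartAt E x).left_inv (mem_chart_source E x)]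
  rfl

theorem tangentMapAt_chartAt (x : M) :
    (tangentMapAt (chartAt E x) x : E →L[ℝ] E) = ContinuousLinearMap.id ℝ E :=
  mfderiv_extChartAt_self (I := 𝓘(ℝ, E)) (x := x)

theorem viaChart_apply_eq {k l : ℕ} {D : (E → E [⋀^Fin k]→L[ℝ] F) → E → E [⋀^Fin l]→L[ℝ] F}
    (α : DForm E M k F) (x : M) :
    α.viaChart D x = D (α.inChart (chartAt E x)) (chartAt E x x) := by
  rw [DForm.viaChart, DForm.pullback, tangentMapAt_chartAt]
  rfl

end Holomorphic

/-! ### Local potentials -/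

section LocalPotential

variable {E : Type*} [NormedAddCommGroup E] [NormedSpace ℂ E]
variable {X : Type*} [TopologicalSpace X] [ChartedSpace E X]

theorem contDiffAt_ofSubsingleton {n : WithTop ℕ∞} {A : E → E →L[ℝ] ℝ} {y : E}
    (h : ContDiffAt ℝ n A y) :
    ContDiffAt ℝ n (fun z => ContinuousAlternatingMap.ofSubsingleton ℝ E ℝ (0 : Fin 1) (A z)) y :=
  ((ContinuousAlternatingMap.ofSubsingletonLIE (𝕜 := ℝ) (E := E) (F := ℝ)
    (0 : Fin 1)).toContinuousLinearEquiv.contDiff.contDiffAt).comp y h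

theorem pullback_differential {ψ : X → ℝ} (hψ : ContMDiff 𝓘(ℝ, E) 𝓘(ℝ, ℝ) ∞ ψ) {r : E → X}
    {y : E} (hr : ContMDiffAt 𝓘(ℂ, E) 𝓘(ℂ, E) ω r y) :
    DForm.pullback r (differential (E := E) ψ) y =
      ContinuousAlternatingMap.ofSubsingleton ℝ E ℝ (0 : Fin 1) (fderiv ℝ (ψ ∘ r) y) := by
  let A : E →L[ℝ] ℝ := mfderiv 𝓘(ℝ, E) 𝓘(ℝ, ℝ) ψ (r y)
  have h1 : fderiv ℝ (ψ ∘ r) y = A.comp (tangentMapAt r y) := by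
    rw [← mfderiv_eq_fderiv]
    exact mfderiv_comp y ((hψ (r y)).mdifferentiableAt (by simp)) hr.mdifferentiableAt_real
  rw [h1]
  rfl

theorem pullback_conj (α : DForm E X 1 ℝ) {r : E → X} {y : E}
    (hr : ContMDiffAt 𝓘(ℂ, E) 𝓘(ℂ, E) ω r y) :
    DForm.pullback r α.conj y =
      (DForm.pullback r α y).compContinuousLinearMap (tangentI E) := by
  ext v
  refine congrArg (α (r y)) (funext fun i => ?_)
  exact (tangentMapAt_tangentI hr (v i)).symm

theorem contDiffAt_comp_real {ψ : X → ℝ} (hψ : ContMDiff 𝓘(ℝ, E) 𝓘(ℝ, ℝ) ∞ ψ) {r : E → X}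
    {y : E} (hr : ContMDiffAt 𝓘(ℝ, E) 𝓘(ℝ, E) ∞ r y) : ContDiffAt ℝ ∞ (ψ ∘ r) y :=
  contMDiffAt_iff_contDiffAt.1 ((hψ (r y)).comp y hr)

theorem contDiffAt_comp_of_holomorphic {ψ : X → ℝ} (hψ : ContMDiff 𝓘(ℝ, E) 𝓘(ℝ, ℝ) ∞ ψ)
    {r : E → X} {y : E} (hr : ContMDiffAt 𝓘(ℂ, E) 𝓘(ℂ, E) ω r y) : ContDiffAt ℝ ∞ (ψ ∘ r) y := by
  refine contDiffAt_comp_real hψ ?_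
  have h1 := contMDiffAt_iff.1 hr
  refine contMDiffAt_iff.2 ⟨h1.1, ?_⟩
  exact (h1.2.restrict_scalars ℝ).of_le (by simp)

variable [IsManifold 𝓘(ℂ, E) ω X]

/-- The form `dd^c ψ` is expressed by the flat operator `dd^c` in holomorphic coordinates. -/
theorem pullback_ddc {ψ : X → ℝ} (hψ : ContMDiff 𝓘(ℝ, E) 𝓘(ℝ, ℝ) ∞ ψ) {r : E → X}
    {y : E} (hr : ContMDiffAt 𝓘(ℂ, E) 𝓘(ℂ, E) ω r y) :
    DForm.pullback r (ddc (E := E) ψ) y = localDdc (ψ ∘ r) y := by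
  have hconj (r : E → X) (y : E) (hr : ContMDiffAt 𝓘(ℂ, E) 𝓘(ℂ, E) ω r y) :
      DForm.pullback r (differential (E := E) ψ).conj =ᶠ[𝓝 y] fun z =>
        ContinuousAlternatingMap.ofSubsingleton ℝ E ℝ (0 : Fin 1)
          ((fderiv ℝ (ψ ∘ r) z).comp (tangentI E)) := by
    filter_upwards [eventually_contMDiffAt hr] with z hz
    rw [pullback_conj _ hz, pullback_differential hψ hz]
    rfl
  set c := chartAt E (r y)
  have hc := contMDiffAt_chart_symm (chart_mem_atlas E (r y))
    (c.map_source (mem_chart_source E (r y)))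
  have hd : DifferentiableAt ℝ ((differential (E := E) ψ).conj.inChart c) (c (r y)) := by
    refine DifferentiableAt.congr_of_eventuallyEq ?_ (hconj c.symm _ hc)
    exact (contDiffAt_ofSubsingleton ((contDiffAt_fderiv_infty
      (contDiffAt_comp_of_holomorphic hψ hc)).clm_comp contDiffAt_const)).differentiableAt (by simp)
  exact (pullback_viaChart isNaturalOperator_extDeriv _ hr hd).trans (hconj r y hr).extDeriv_eq

variable {M : Type*} [TopologicalSpace M] [ChartedSpace E M] [IsManifold 𝓘(ℂ, E) ω M]

/-- In a chart, the structure of an LCK manifold with potential is `ω = p⁻¹ dd^c p`,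
`θ = -d log p` for a positive function `p`: the potential composed with a local section of the
covering. -/
theorem IsPotentialCovering.exists_localPotential {g : HermitianMetric E M} {θ : DForm E M 1 ℝ}
    {π : X → M} {h : HermitianMetric E X} {ψ : X → ℝ} (hπ : IsPotentialCovering g θ π h ψ)
    {φ : OpenPartialHomeomorph M E} (hφ : φ ∈ atlas E M) {y₀ : E} (hy₀ : y₀ ∈ φ.target) :
    ∃ p : E → ℝ, (∀ᶠ y in 𝓝 y₀, ContDiffAt ℝ ∞ p y) ∧ (∀ y, 0 < p y) ∧
      (g.form.inChart φ =ᶠ[𝓝 y₀] fun y => (p y)⁻¹ • localDdc p y) ∧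
      θ.inChart φ =ᶠ[𝓝 y₀] fun y => ContinuousAlternatingMap.ofSubsingleton ℝ E ℝ (0 : Fin 1)
        (-((p y)⁻¹ • fderiv ℝ p y)) := by
  obtain ⟨x, hx⟩ := hπ.surjective (φ.symm y₀)
  have hloc := hπ.holomorphic x
  set s := hloc.localInverse
  have hφs := contMDiffAt_chart_symm hφ hy₀
  have hs₀ : φ.symm y₀ ∈ s.source := hx ▸ hloc.localInverse_mem_source
  have hr₀ : ContMDiffAt 𝓘(ℂ, E) 𝓘(ℂ, E) ω (s ∘ φ.symm) y₀ :=
    ContMDiffAt.comp y₀ (hx ▸ hloc.localInverse_contMDiffAt) hφs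
  have hev : ∀ᶠ y in 𝓝 y₀, ContMDiffAt 𝓘(ℂ, E) 𝓘(ℂ, E) ω (s ∘ φ.symm) y ∧
      π ∘ (s ∘ φ.symm) =ᶠ[𝓝 y] φ.symm := by
    refine (eventually_contMDiffAt hr₀).and (Filter.Eventually.eventually_nhds ?_)
    filter_upwards [hφs.continuousAt.eventually (s.open_source.mem_nhds hs₀)] with y hy
    exact hloc.localInverse_right_inv hy
  have hpull {k : ℕ} (α : DForm E M k ℝ) {y : E}
      (hy : ContMDiffAt 𝓘(ℂ, E) 𝓘(ℂ, E) ω (s ∘ φ.symm) y ∧ π ∘ (s ∘ φ.symm) =ᶠ[𝓝 y] φ.symm) :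
      α.inChart φ y = DForm.pullback (s ∘ φ.symm) (DForm.pullback π α) y := by
    rw [DForm.inChart, DForm.pullback, DForm.pullback, DForm.pullback,
      ← tangentMapAt_congr hy.2, ← hy.2.self_of_nhds,
      tangentMapAt_comp (hπ.holomorphic.contMDiff _) hy.1]
    rfl
  have hlog : ContMDiff 𝓘(ℝ, E) 𝓘(ℝ, ℝ) ∞ fun x => -Real.log (ψ x) := fun x =>
    ((Real.contDiffAt_log.2 (hπ.pos x).ne').neg.contMDiffAt).comp x (hπ.smooth x)
  refine ⟨ψ ∘ (s ∘ φ.symm), hev.mono fun y hy => contDiffAt_comp_of_holomorphic hπ.smooth hy.1,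
    fun y => hπ.pos _, hev.mono fun y hy => ?_, hev.mono fun y hy => ?_⟩
  · dsimp only
    rw [hpull _ hy, ← pullback_ddc hπ.smooth hy.1, ← hπ.potential, DForm.pullback, hπ.pullback_form]
    rfl
  · dsimp only
    rw [hpull _ hy, hπ.pullback_lee, pullback_differential hlog hy.1]
    congr 1
    have hd : DifferentiableAt ℝ (ψ ∘ (s ∘ φ.symm)) y :=
      (contDiffAt_comp_of_holomorphic hπ.smooth hy.1).differentiableAt (by simp)
    exact ((hd.hasFDerivAt.log (hπ.pos _).ne').neg).fderiv

end LocalPotential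

section Pointwise

variable {E : Type*} [NormedAddCommGroup E] [NormedSpace ℂ E]

theorem wedgePow_compContinuousLinearMap (η : E [⋀^Fin 2]→L[ℝ] ℝ) (A : E →L[ℝ] E) (k : ℕ) :
    wedgePow (η.compContinuousLinearMap A) k = (wedgePow η k).compContinuousLinearMap A := by
  ext v
  refine mul_left_cancel₀ (pow_ne_zero k (two_ne_zero' ℝ)) ?_
  rw [ContinuousAlternatingMap.compContinuousLinearMap_apply, two_pow_mul_wedgePow,
    two_pow_mul_wedgePow]
  simp only [altSum, ContinuousAlternatingMap.compContinuousLinearMap_apply]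
  refine Finset.sum_congr rfl fun σ _ => congrArg _ (Finset.prod_congr rfl fun i _ => ?_)
  congr 1
  ext j
  fin_cases j <;> rfl

/-- The identity `-dd^c log p = -p⁻¹ dd^c p + θ ∧ θ^c` for `θ = d log p`. -/
theorem localDdc_neg_log_apply {p : E → ℝ} {y : E} (hp : ∀ᶠ z in 𝓝 y, ContDiffAt ℝ ∞ p z)
    (hpos : ∀ z, 0 < p z) (v w : E) :
    extDeriv (fun z => ContinuousAlternatingMap.ofSubsingleton ℝ E ℝ (0 : Fin 1)
      ((-((p z)⁻¹ • fderiv ℝ p z)).comp (tangentI E))) y ![v, w] =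
    -((p y)⁻¹ * localDdc p y ![v, w]) +
      ((p y)⁻¹ * fderiv ℝ p y v * ((p y)⁻¹ * fderiv ℝ p y (tangentI E w)) -
        (p y)⁻¹ * fderiv ℝ p y w * ((p y)⁻¹ * fderiv ℝ p y (tangentI E v))) := by
  have h1 : fderiv ℝ (fun z => -Real.log (p z)) =ᶠ[𝓝 y] fun z => -((p z)⁻¹ • fderiv ℝ p z) := by
    filter_upwards [hp] with z hz
    exact (((hz.differentiableAt (by simp)).hasFDerivAt.log (hpos z).ne').neg).fderiv
  have hy := hp.self_of_nhds
  have hf : ContDiffAt ℝ 2 (fun z => -Real.log (p z)) y :=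
    ((hy.of_le two_le_infty).log (hpos y).ne').neg
  have h2 : extDeriv (fun z => ContinuousAlternatingMap.ofSubsingleton ℝ E ℝ (0 : Fin 1)
      ((-((p z)⁻¹ • fderiv ℝ p z)).comp (tangentI E))) y =
      localDdc (fun z => -Real.log (p z)) y := by
    refine Filter.EventuallyEq.extDeriv_eq (h1.mono fun z hz => ?_)
    dsimp only
    rw [hz]
  have h3 (a b : E) : fderiv ℝ (fderiv ℝ fun z => -Real.log (p z)) y a b =
      -((p y)⁻¹ * fderiv ℝ (fderiv ℝ p) y a b) +
        (p y)⁻¹ * fderiv ℝ p y a * ((p y)⁻¹ * fderiv ℝ p y b) := by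
    have h4 : HasFDerivAt p (fderiv ℝ p y) y := (hy.differentiableAt (by simp)).hasFDerivAt
    have h5 : HasFDerivAt (fderiv ℝ p) (fderiv ℝ (fderiv ℝ p) y) y :=
      ((contDiffAt_fderiv_infty hy).differentiableAt (by simp)).hasFDerivAt
    have h6 := (((hasDerivAt_inv (hpos y).ne').comp_hasFDerivAt y h4).smul h5).neg
    have h7 := h6.fderiv
    rw [h1.fderiv_eq]
    have h8 := congrArg (fun A : E →L[ℝ] E →L[ℝ] ℝ => A a b) h7
    refine h8.trans ?_
    simp
    ring
  rw [h2, localDdc_apply hf, localDdc_apply (hy.of_le two_le_infty), h3, h3]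
  ring

end Pointwise

section LCK

variable {E : Type*} [NormedAddCommGroup E] [NormedSpace ℂ E]
variable {M : Type*} [TopologicalSpace M] [ChartedSpace E M]

theorem inChart_wedgePow (η : DForm E M 2 ℝ) (k : ℕ) (φ : OpenPartialHomeomorph M E) :
    DForm.inChart φ (fun x => wedgePow (η x) k) = fun y => wedgePow (η.inChart φ y) k :=
  funext fun _ => (wedgePow_compContinuousLinearMap _ _ k).symm

theorem DForm.IsSmooth.wedgePow [FiniteDimensional ℂ E] {η : DForm E M 2 ℝ} (hη : η.IsSmooth)
    (k : ℕ) : DForm.IsSmooth fun x => wedgePow (η x) k := by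
  rw [isSmooth_iff_contDiffAt] at *
  intro φ hφ y hy
  rw [inChart_wedgePow]
  exact contDiffAt_wedgePow (hη φ hφ y hy) k

variable [IsManifold 𝓘(ℂ, E) ω M]
variable {X : Type*} [TopologicalSpace X] [ChartedSpace E X] [IsManifold 𝓘(ℂ, E) ω X]
variable {g : HermitianMetric E M} {θ : DForm E M 1 ℝ} {π : X → M} {h : HermitianMetric E X}
  {ψ : X → ℝ}

theorem IsPotentialCovering.isSmooth_form (hπ : IsPotentialCovering g θ π h ψ) :
    g.form.IsSmooth := by
  refine isSmooth_iff_contDiffAt.2 fun φ hφ y hy => ?_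
  obtain ⟨p, hp, hpos, hω, -⟩ := hπ.exists_localPotential hφ hy
  exact ((hp.self_of_nhds.inv (hpos y).ne').smul
    (contDiffAt_localDdc hp.self_of_nhds)).congr_of_eventuallyEq hω

/-- The identity `ω₀ = ω - θ ∧ θ^c`. -/
theorem IsPotentialCovering.omegaZero_apply (hπ : IsPotentialCovering g θ π h ψ) (x : M)
    (v w : E) : omegaZero θ x ![v, w] = g.bilin x v (tangentI E w) -
      (θ x (fun _ => v) * θ x (fun _ => tangentI E w) -
        θ x (fun _ => w) * θ x (fun _ => tangentI E v)) := by
  set c := chartAt E x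
  have hc := chart_mem_atlas E x
  have hx := c.map_source (mem_chart_source E x)
  obtain ⟨p, hp, hpos, hω, hθ⟩ := hπ.exists_localPotential hc hx
  have h1 : θ.conj.inChart c =ᶠ[𝓝 (c x)] fun z =>
      ContinuousAlternatingMap.ofSubsingleton ℝ E ℝ (0 : Fin 1)
        ((-((p z)⁻¹ • fderiv ℝ p z)).comp (tangentI E)) := by
    filter_upwards [hθ, c.open_target.mem_nhds hx] with z hz hz'
    rw [DForm.inChart, pullback_conj _ (contMDiffAt_chart_symm hc hz')]
    change (DForm.inChart c θ z).compContinuousLinearMap _ = _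
    rw [hz]
    rfl
  have h2 := inChart_chartAt_self θ x
  have h3 := inChart_chartAt_self g.form x
  rw [hθ.self_of_nhds] at h2
  rw [hω.self_of_nhds] at h3
  have h4 (u : E) : θ x (fun _ => u) = -((p (c x))⁻¹ * fderiv ℝ p (c x) u) := by
    rw [← h2]; rfl
  have h5 : g.bilin x v (tangentI E w) = (p (c x))⁻¹ * localDdc p (c x) ![v, w] :=
    (congrArg (fun η : E [⋀^Fin 2]→L[ℝ] ℝ => η ![v, w]) h3).symm
  have h6 : omegaZero θ x = -extDeriv (θ.conj.inChart c) (c x) :=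
    congrArg Neg.neg (viaChart_apply_eq _ x)
  rw [h6, h1.extDeriv_eq, ContinuousAlternatingMap.neg_apply, localDdc_neg_log_apply hp hpos,
    h4, h4, h4, h4, h5]
  ring

/-- With `N = n - 1`, the top-degree form `dd^c ω^N` on an LCK manifold with potential is, up to a
constant, `(-ω / 2 + n θ ⊗ θ^c) ∧ ω^N`. -/
theorem IsPotentialCovering.two_pow_mul_d_dc_wedgePow [FiniteDimensional ℂ E]
    (hπ : IsPotentialCovering g θ π h ψ) {N : ℕ} (x : M) (v : Fin (2 * N + 1 + 1) → E) :
    2 ^ N * (DForm.viaChart localDc fun x => wedgePow (g.form x) N).d x v =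
      N * altSum (fun w => (-(1 / 2) * g.bilin x (w 0) (tangentI E (w 1)) +
        (N + 1) * θ x (fun _ => w 0) * θ x (fun _ => tangentI E (w 1))) *
        ∏ i : Fin N, g.bilin x (w (pairIndex i 0).succ.succ)
          (tangentI E (w (pairIndex i 1).succ.succ))) v := by
  set c := chartAt E x
  have hc := chart_mem_atlas E x
  have hx := c.map_source (mem_chart_source E x)
  obtain ⟨p, hp, hpos, hω, hθ⟩ := hπ.exists_localPotential hc hx
  have hW := hπ.isSmooth_form.wedgePow N
  have h1 : (DForm.viaChart localDc fun x => wedgePow (g.form x) N).inChart c =ᶠ[𝓝 (c x)]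
      localDc fun y => wedgePow (g.form.inChart c y) N := by
    filter_upwards [c.open_target.mem_nhds hx] with z hz
    rw [viaChart_inChart isNaturalOperator_localDc hW hc hz, inChart_wedgePow]
  have h2 := inChart_chartAt_self θ x
  rw [hθ.self_of_nhds] at h2
  have h4 (u : E) : (p (c x))⁻¹ * fderiv ℝ p (c x) u = -θ x (fun _ => u) := by
    rw [← h2]
    exact (neg_neg _).symm
  have h5 (u u' : E) : g.form.inChart (chartAt E x) (c x) ![u, u'] =
      g.bilin x u (tangentI E u') := by
    rw [inChart_chartAt_self]
    rfl
  rw [DForm.d, viaChart_apply_eq, h1.extDeriv_eq,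
    two_pow_mul_extDeriv_localDc_wedgePow hp (hpos _).ne' hω]
  simp only [h4, h5, mul_neg, neg_mul, neg_neg]

end LCK

/-! ### The operators `∂` and `∂̄` in terms of `d` and `d^c` -/

section DelDelBar

open ContinuousAlternatingMap

variable {E : Type*} [NormedAddCommGroup E] [NormedSpace ℂ E]
variable {F : Type*} [NormedAddCommGroup F] [NormedSpace ℝ F]
variable {k : ℕ}

theorem fderiv_alternatizeUncurryFin {A : E → E →L[ℝ] E [⋀^Fin k]→L[ℝ] F} {y : E}
    (hA : DifferentiableAt ℝ A y) :
    fderiv ℝ (fun z => alternatizeUncurryFin (A z)) y =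
      alternatizeUncurryFinCLM ℝ E F ∘L fderiv ℝ A y := by
  have h : fderiv ℝ (fun z => alternatizeUncurryFinCLM ℝ E F (A z)) y = _ :=
    (alternatizeUncurryFinCLM ℝ E F).hasFDerivAt.comp y hA.hasFDerivAt |>.fderiv
  exact h

theorem fderiv_clm_comp_tangentI {A : E → E →L[ℝ] F} {y : E} (hA : DifferentiableAt ℝ A y)
    (v w : E) : fderiv ℝ (fun z => (A z).comp (tangentI E)) y v w =
      fderiv ℝ A y v (tangentI E w) :=
  congrArg (fun B : E →L[ℝ] E →L[ℝ] F => B v w)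
    (((ContinuousLinearMap.compL ℝ E E F).flip (tangentI E)).hasFDerivAt.comp y
      hA.hasFDerivAt).fderiv

/-- As for `d ∘ d`, the second derivative enters through a symmetric bilinear map, here
`(v, w) ↦ D²β(Iv, Iw)`. -/
theorem localDc_localDc {β : E → E [⋀^Fin k]→L[ℝ] F} {y : E} (hβ : ContDiffAt ℝ ∞ β y) :
    localDc (localDc β) y = 0 := by
  have h1 : DifferentiableAt ℝ (fderiv ℝ β) y :=
    (contDiffAt_fderiv_infty hβ).differentiableAt (by simp)
  have h2 : DifferentiableAt ℝ (fun z => (fderiv ℝ β z).comp (tangentI E)) y :=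
    h1.clm_comp (differentiableAt_const _)
  have h3 : localDc (localDc β) y = alternatizeUncurryFin ((fderiv ℝ (fun z =>
      alternatizeUncurryFin ((fderiv ℝ β z).comp (tangentI E))) y).comp (tangentI E)) := rfl
  rw [h3, fderiv_alternatizeUncurryFin h2, ContinuousLinearMap.comp_assoc]
  refine alternatizeUncurryFin_alternatizeUncurryFinCLM_comp_of_symmetric fun v w => ?_
  rw [ContinuousLinearMap.comp_apply, ContinuousLinearMap.comp_apply, fderiv_clm_comp_tangentI h1,
    fderiv_clm_comp_tangentI h1, fderiv_fderiv_comm (hβ.of_le two_le_infty)]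

/-- The bilinear map `(v, w) ↦ D²β(Iv, w) + D²β(v, Iw)` is symmetric. -/
theorem localDc_extDeriv {β : E → E [⋀^Fin k]→L[ℝ] F} {y : E} (hβ : ContDiffAt ℝ ∞ β y) :
    localDc (extDeriv β) y = -extDeriv (localDc β) y := by
  have h1 : DifferentiableAt ℝ (fderiv ℝ β) y :=
    (contDiffAt_fderiv_infty hβ).differentiableAt (by simp)
  have h2 : DifferentiableAt ℝ (fun z => (fderiv ℝ β z).comp (tangentI E)) y :=
    h1.clm_comp (differentiableAt_const _)
  have h3 : localDc (extDeriv β) y = alternatizeUncurryFin ((fderiv ℝ (fun z =>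
      alternatizeUncurryFin (fderiv ℝ β z)) y).comp (tangentI E)) := rfl
  have h4 : extDeriv (localDc β) y = alternatizeUncurryFin (fderiv ℝ (fun z =>
      alternatizeUncurryFin ((fderiv ℝ β z).comp (tangentI E))) y) := rfl
  rw [eq_neg_iff_add_eq_zero, h3, h4, fderiv_alternatizeUncurryFin h1,
    fderiv_alternatizeUncurryFin h2,
    ContinuousLinearMap.comp_assoc, ← alternatizeUncurryFin_add, ← ContinuousLinearMap.comp_add]
  refine alternatizeUncurryFin_alternatizeUncurryFinCLM_comp_of_symmetric fun v w => ?_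
  rw [_root_.add_apply, _root_.add_apply, _root_.add_apply, _root_.add_apply,
    ContinuousLinearMap.comp_apply, ContinuousLinearMap.comp_apply,
    fderiv_clm_comp_tangentI h1, fderiv_clm_comp_tangentI h1,
    fderiv_fderiv_comm (hβ.of_le two_le_infty) v, add_comm,
    fderiv_fderiv_comm (hβ.of_le two_le_infty) w]

theorem localDelBar_eq (α : E → E [⋀^Fin k]→L[ℝ] ℂ) (y : E) :
    localDelBar α y = (1 / 2 : ℂ) • (extDeriv α y + Complex.I • localDc α y) := by
  rw [localDelBar, alternatizeUncurryFin_smul, alternatizeUncurryFin_add,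
    alternatizeUncurryFin_smul]
  rfl

theorem localDel_eq (α : E → E [⋀^Fin k]→L[ℝ] ℂ) (y : E) :
    localDel α y = (1 / 2 : ℂ) • (extDeriv α y - Complex.I • localDc α y) := by
  have h1 : alternatizeUncurryFin (fderiv ℝ α y -
      Complex.I • (fderiv ℝ α y).comp (tangentI E)) = extDeriv α y - Complex.I • localDc α y := by
    rw [localDc, ← alternatizeUncurryFin_smul]
    exact map_sub (alternatizeUncurryFinCLM ℝ E ℂ) _ _
  rw [← h1, ← alternatizeUncurryFin_smul]
  rfl

theorem fderiv_localDelBar {α : E → E [⋀^Fin k]→L[ℝ] ℂ} {y : E} (hα : ContDiffAt ℝ ∞ α y) :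
    fderiv ℝ (localDelBar α) y = (1 / 2 : ℂ) • (fderiv ℝ (extDeriv α) y +
      Complex.I • fderiv ℝ (localDc α) y) := by
  have h1 := ((contDiffAt_extDeriv hα).differentiableAt (by simp)).hasFDerivAt
  have h2 := ((contDiffAt_localDc hα).differentiableAt (by simp)).hasFDerivAt
  rw [funext (localDelBar_eq α)]
  exact ((h1.add (h2.const_smul Complex.I)).const_smul (1 / 2 : ℂ)).fderiv

theorem localDel_localDelBar {α : E → E [⋀^Fin k]→L[ℝ] ℂ} {y : E} (hα : ContDiffAt ℝ ∞ α y) :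
    localDel (localDelBar α) y = (Complex.I / 2) • extDeriv (localDc α) y := by
  have h1 : extDeriv (localDelBar α) y = (Complex.I / 2) • extDeriv (localDc α) y := by
    rw [extDeriv, fderiv_localDelBar hα, alternatizeUncurryFin_smul, alternatizeUncurryFin_add,
      alternatizeUncurryFin_smul]
    change (1 / 2 : ℂ) • (extDeriv (extDeriv α) y + Complex.I • extDeriv (localDc α) y) = _
    rw [extDeriv_extDeriv_apply (hα.of_le two_le_infty) (by simp), zero_add, smul_smul]
    congr 1
    ring
  have h2 : localDc (localDelBar α) y = -(1 / 2 : ℂ) • extDeriv (localDc α) y := by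
    rw [localDc, fderiv_localDelBar hα, ContinuousLinearMap.smul_comp,
      ContinuousLinearMap.add_comp, ContinuousLinearMap.smul_comp, alternatizeUncurryFin_smul,
      alternatizeUncurryFin_add, alternatizeUncurryFin_smul]
    change (1 / 2 : ℂ) • (localDc (extDeriv α) y + Complex.I • localDc (localDc α) y) = _
    rw [localDc_localDc hα, localDc_extDeriv hα, smul_zero, add_zero, smul_neg, neg_smul]
  rw [localDel_eq, h1, h2, smul_smul, ← sub_smul, smul_smul]
  congr 1
  ring

theorem isNaturalOperator_localDelBar :
    IsNaturalOperator (localDelBar : (E → E [⋀^Fin k]→L[ℝ] ℂ) → _) where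
  congr α β y h := by
    rw [localDelBar_eq, localDelBar_eq, isNaturalOperator_extDeriv.congr _ _ _ h,
      isNaturalOperator_localDc.congr _ _ _ h]
  pullback τ β y hτ hβ := by
    rw [localDelBar_eq, localDelBar_eq, isNaturalOperator_extDeriv.pullback _ _ _ hτ hβ,
      isNaturalOperator_localDc.pullback _ _ _ hτ hβ]
    rfl
  smooth β y h := by
    rw [funext (localDelBar_eq β)]
    exact ((contDiffAt_extDeriv h).add ((contDiffAt_localDc h).const_smul Complex.I)).const_smul
      (1 / 2 : ℂ)

theorem fderiv_toComplex {β : E → E [⋀^Fin k]→L[ℝ] ℝ} {y : E} (hβ : DifferentiableAt ℝ β y) :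
    fderiv ℝ (fun z => Complex.ofRealCLM.compContinuousAlternatingMap (β z)) y =
      (ContinuousLinearMap.compContinuousAlternatingMapCLM ℝ E ℝ ℂ (Fin k)
        Complex.ofRealCLM).comp (fderiv ℝ β y) := by
  have h : HasFDerivAt (ContinuousLinearMap.compContinuousAlternatingMapCLM ℝ E ℝ ℂ (Fin k)
    Complex.ofRealCLM) _ (β y) := ContinuousLinearMap.hasFDerivAt _
  exact (h.comp y hβ.hasFDerivAt).fderiv

theorem contDiffAt_toComplex {β : E → E [⋀^Fin k]→L[ℝ] ℝ} {y : E} (hβ : ContDiffAt ℝ ∞ β y) :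
    ContDiffAt ℝ ∞ (fun z => Complex.ofRealCLM.compContinuousAlternatingMap (β z)) y :=
  ContDiffAt.comp (g := ContinuousLinearMap.compContinuousAlternatingMapCLM ℝ E ℝ ℂ (Fin k)
    Complex.ofRealCLM) y (ContinuousLinearMap.contDiff _).contDiffAt hβ

theorem alternatizeUncurryFin_toComplex (A : E →L[ℝ] E [⋀^Fin k]→L[ℝ] ℝ) :
    alternatizeUncurryFin ((ContinuousLinearMap.compContinuousAlternatingMapCLM ℝ E ℝ ℂ (Fin k)
      Complex.ofRealCLM).comp A) =
      Complex.ofRealCLM.compContinuousAlternatingMap (alternatizeUncurryFin A) := by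
  ext v
  simp [alternatizeUncurryFin_apply]

theorem extDeriv_localDc_toComplex {β : E → E [⋀^Fin k]→L[ℝ] ℝ} {y : E}
    (hβ : ContDiffAt ℝ ∞ β y) :
    extDeriv (localDc fun z => Complex.ofRealCLM.compContinuousAlternatingMap (β z)) y =
      Complex.ofRealCLM.compContinuousAlternatingMap (extDeriv (localDc β) y) := by
  have h1 : (localDc fun z => Complex.ofRealCLM.compContinuousAlternatingMap (β z)) =ᶠ[𝓝 y]
      fun z => Complex.ofRealCLM.compContinuousAlternatingMap (localDc β z) := by
    filter_upwards [eventually_contDiffAt_two hβ] with z hz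
    rw [localDc, fderiv_toComplex (hz.differentiableAt (by simp)),
      ContinuousLinearMap.comp_assoc, alternatizeUncurryFin_toComplex]
    rfl
  rw [h1.extDeriv_eq, extDeriv, fderiv_toComplex ((contDiffAt_localDc hβ).differentiableAt
    (by simp)), alternatizeUncurryFin_toComplex]
  rfl

variable {M : Type*} [TopologicalSpace M] [ChartedSpace E M]

theorem DForm.IsSmooth.toComplex {α : DForm E M k ℝ} (hα : α.IsSmooth) : α.toComplex.IsSmooth :=
  isSmooth_iff_contDiffAt.2 fun φ hφ y hy =>
    contDiffAt_toComplex (isSmooth_iff_contDiffAt.1 hα φ hφ y hy)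

variable [IsManifold 𝓘(ℂ, E) ω M]

/-- The identity `∂∂̄ = (i / 2) dd^c` on real forms. -/
theorem del_delBar_toComplex {α : DForm E M k ℝ} (hα : α.IsSmooth) (x : M) :
    α.toComplex.delBar.del x = (Complex.I / 2) •
      Complex.ofRealCLM.compContinuousAlternatingMap ((α.viaChart localDc).d x) := by
  set c := chartAt E x with hc'
  have hc := chart_mem_atlas E x
  have hx := c.map_source (mem_chart_source E x)
  have hβ : ContDiffAt ℝ ∞ (α.inChart c) (c x) := isSmooth_iff_contDiffAt.1 hα c hc _ hx
  have h1 : α.toComplex.delBar.inChart c =ᶠ[𝓝 (c x)] localDelBar (α.toComplex.inChart c) := by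
    filter_upwards [c.open_target.mem_nhds hx] with z hz
    exact viaChart_inChart isNaturalOperator_localDelBar hα.toComplex hc hz
  have h2 : (α.viaChart localDc).inChart c =ᶠ[𝓝 (c x)] localDc (α.inChart c) := by
    filter_upwards [c.open_target.mem_nhds hx] with z hz
    exact viaChart_inChart isNaturalOperator_localDc hα hc hz
  have h3 : localDel (α.toComplex.delBar.inChart c) (c x) =
      localDel (localDelBar (α.toComplex.inChart c)) (c x) := by
    rw [localDel, h1.fderiv_eq]
    rfl
  rw [DForm.del, viaChart_apply_eq, DForm.d, viaChart_apply_eq, ← hc', h2.extDeriv_eq, h3,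
    ← extDeriv_localDc_toComplex hβ]
  exact localDel_localDelBar (contDiffAt_toComplex hβ)

theorem del_delBar_toComplex_eq_zero_iff {α : DForm E M k ℝ} (hα : α.IsSmooth) :
    α.toComplex.delBar.del = 0 ↔ (α.viaChart localDc).d = 0 := by
  refine ⟨fun h => ?_, fun h => funext fun x => ?_⟩
  · ext x v
    have h1 := congrArg (fun β : E [⋀^Fin (k + 1 + 1)]→L[ℝ] ℂ => β v)
      ((del_delBar_toComplex hα x).symm.trans (congrFun h x))
    simpa using h1
  · rw [del_delBar_toComplex hα, h]
    ext v
    simp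

end DelDelBar

/-! ### Stokes' theorem -/

section Stokes

open MeasureTheory

variable {E : Type*} [NormedAddCommGroup E] [NormedSpace ℂ E]
variable {m : ℕ}

/-- A top form that vanishes on a basis is zero. -/
theorem ContinuousAlternatingMap.eq_zero_of_map_basis {ι : Type*} [Fintype ι] [DecidableEq ι]
    (K : E [⋀^ι]→L[ℝ] ℝ) (b : Module.Basis ι ℝ E) (h : K b = 0) : K = 0 := by
  ext v
  have h1 := congrArg (fun A : E [⋀^ι]→ₗ[ℝ] ℝ => A v) (K.toAlternatingMap.eq_smul_basis_det b)
  refine h1.trans ?_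
  change K b • b.det v = 0
  rw [h, zero_smul]

theorem ContDiffAt.alternatingMap_apply {n : WithTop ℕ∞} {β : E → E [⋀^Fin m]→L[ℝ] ℝ} {y : E}
    (hβ : ContDiffAt ℝ n β y) (v : Fin m → E) : ContDiffAt ℝ n (fun z => β z v) y :=
  ContDiffAt.comp (g := ContinuousAlternatingMap.apply ℝ E ℝ v) y
    (ContinuousLinearMap.contDiff _).contDiffAt hβ

variable {M : Type*} [TopologicalSpace M] [ChartedSpace E M]

theorem inChart_eq_zero {l : ℕ} {φ : OpenPartialHomeomorph M E} {α : DForm E M l ℝ} {y : E}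
    (h : α (φ.symm y) = 0) : α.inChart φ y = 0 := by
  rw [DForm.inChart, DForm.pullback, h]
  rfl

theorem DForm.IsSmooth.continuousOn_inChart_apply {l : ℕ} {α : DForm E M l ℝ} (hα : α.IsSmooth)
    {φ : OpenPartialHomeomorph M E} (hφ : φ ∈ atlas E M) (v : Fin l → E) :
    ContinuousOn (fun y => α.inChart φ y v) φ.target := fun y hy =>
  ((isSmooth_iff_contDiffAt.1 hα φ hφ y hy).alternatingMap_apply v).continuousAt.continuousWithinAt

section Integrable

variable [MeasurableSpace E] (μ : Measure E)

/-- The integral of a form of top degree over the domain of a chart, normalized by the choice of a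
basis `b` of the model space: the value of the form on `b` is integrated. -/
noncomputable def chartIntegral {l : ℕ} (b : Fin l → E) (φ : OpenPartialHomeomorph M E)
    (α : DForm E M l ℝ) : ℝ :=
  ∫ y in φ.target, α.inChart φ y b ∂μ

theorem chartIntegral_sum {ι : Type*} [Fintype ι] {l : ℕ} {φ : OpenPartialHomeomorph M E}
    {α : ι → DForm E M l ℝ} {v : Fin l → E}
    (h : ∀ i, IntegrableOn (fun y => (α i).inChart φ y v) φ.target μ) :
    chartIntegral μ v φ (fun x => ∑ i, α i x) = ∑ i, chartIntegral μ v φ (α i) := by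
  simp only [chartIntegral]
  rw [← integral_finsetSum _ fun i _ => h i]
  congr 1
  ext y
  simp [DForm.inChart, DForm.pullback]

variable [BorelSpace E] [μ.IsAddHaarMeasure]

theorem integrableOn_inChart {l : ℕ} {α : DForm E M l ℝ} (hα : α.IsSmooth)
    {φ : OpenPartialHomeomorph M E} (hφ : φ ∈ atlas E M) {K : Set M} (hK : IsCompact K)
    (hKφ : K ⊆ φ.source) (h0 : ∀ x ∉ K, α x = 0) (v : Fin l → E) :
    IntegrableOn (fun y => α.inChart φ y v) φ.target μ := by
  have h1 : φ '' K ⊆ φ.target := by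
    rintro _ ⟨x, hx, rfl⟩
    exact φ.map_source (hKφ hx)
  have h2 : IntegrableOn (fun y => α.inChart φ y v) (φ '' K) μ :=
    ((hα.continuousOn_inChart_apply hφ v).mono h1).integrableOn_compact
      (hK.image_of_continuousOn (φ.continuousOn.mono hKφ))
  refine h2.of_forall_sdiff_eq_zero φ.open_target.measurableSet fun y hy => ?_
  rw [inChart_eq_zero (h0 _ fun h => hy.2 ⟨_, h, φ.right_inv hy.1⟩)]
  rfl

end Integrable

variable [IsManifold 𝓘(ℂ, E) ω M]

theorem eq_zero_of_inChart_eq_zero {l : ℕ} {φ : OpenPartialHomeomorph M E} (hφ : φ ∈ atlas E M)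
    {α : DForm E M l ℝ} {x : M} (hx : x ∈ φ.source) (h : α.inChart φ (φ x) = 0) : α x = 0 := by
  have hc := (chartAt E x).map_source (mem_chart_source E x)
  have hl := (chartAt E x).left_inv (mem_chart_source E x)
  have h1 := pullback_eq_inChart hφ α (r := (chartAt E x).symm) (y := chartAt E x x)
    (contMDiffAt_chart_symm (chart_mem_atlas E x) hc) (hl.symm ▸ hx)
  rw [hl, h] at h1
  rw [← inChart_chartAt_self α x, DForm.inChart, h1]
  rfl

theorem DForm.IsSmooth.smul {l : ℕ} {χ : M → ℝ} (hχ : ContMDiff 𝓘(ℝ, E) 𝓘(ℝ, ℝ) ∞ χ)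
    {α : DForm E M l ℝ} (hα : α.IsSmooth) : DForm.IsSmooth fun x => χ x • α x := by
  rw [isSmooth_iff_contDiffAt] at *
  intro φ hφ y hy
  exact (contDiffAt_comp_of_holomorphic hχ (contMDiffAt_chart_symm hφ hy)).smul (hα φ hφ y hy)

theorem d_eq_zero_of_eventually_eq_zero {l : ℕ} {α : DForm E M l ℝ} {x : M}
    (h : ∀ᶠ z in 𝓝 x, α z = 0) : α.d x = 0 := by
  have hx := (chartAt E x).map_source (mem_chart_source E x)
  have hl := (chartAt E x).left_inv (mem_chart_source E x)
  have h1 : α.inChart (chartAt E x) =ᶠ[𝓝 (chartAt E x x)] fun _ => 0 := by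
    have h2 : Filter.Tendsto (chartAt E x).symm (𝓝 (chartAt E x x)) (𝓝 x) := by
      have := (chartAt E x).continuousAt_symm hx
      rwa [ContinuousAt, hl] at this
    exact (h2.eventually h).mono fun y hy => inChart_eq_zero hy
  rw [DForm.d, viaChart_apply_eq, h1.extDeriv_eq, extDeriv, fderiv_fun_const]
  exact map_zero (ContinuousAlternatingMap.alternatizeUncurryFinCLM ℝ E ℝ)

theorem d_sum {ι : Type*} [Fintype ι] {l : ℕ} {α : ι → DForm E M l ℝ} (hα : ∀ i, (α i).IsSmooth)
    (x : M) : DForm.d (fun x => ∑ i, α i x) x = ∑ i, (α i).d x := by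
  have hx := (chartAt E x).map_source (mem_chart_source E x)
  have h1 : DForm.inChart (chartAt E x) (fun x => ∑ i, α i x) =
      fun y => ∑ i, (α i).inChart (chartAt E x) y := by
    ext y v
    simp [DForm.inChart, DForm.pullback]
  simp only [DForm.d, viaChart_apply_eq]
  rw [h1, extDeriv, fderiv_fun_sum fun i _ => (isSmooth_iff_contDiffAt.1 (hα i) _
    (chart_mem_atlas E x) _ hx).differentiableAt (by simp)]
  exact map_sum (ContinuousAlternatingMap.alternatizeUncurryFinCLM ℝ E ℝ) _ _

variable [FiniteDimensional ℂ E]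

theorem inChart_nonneg {l : ℕ} (b : Module.Basis (Fin l) ℝ E) {φ : OpenPartialHomeomorph M E}
    (hφ : φ ∈ atlas E M) {α : DForm E M l ℝ} {y : E} (hy : y ∈ φ.target)
    (h : 0 ≤ α (φ.symm y) b) : 0 ≤ α.inChart φ y b := by
  obtain ⟨L, hL⟩ := exists_tangentMapAt_eq_restrictScalars (contMDiffAt_chart_symm hφ hy)
  have h1 : α.inChart φ y b = Complex.normSq (LinearMap.det L.toLinearMap) * α (φ.symm y) b := by
    rw [← map_comp_complexLinear, DForm.inChart, DForm.pullback, hL]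
    rfl
  rw [h1]
  exact mul_nonneg (Complex.normSq_nonneg _) h

instance finiteDimensional_real_of_complex : FiniteDimensional ℝ E :=
  FiniteDimensional.complexToReal E

section Integral

variable [MeasurableSpace E] [BorelSpace E] (μ : Measure E) [μ.IsAddHaarMeasure]

theorem integral_fderiv_apply_eq_zero {f : E → ℝ} (hf : ContDiff ℝ ∞ f) (hs : HasCompactSupport f)
    (v : E) : ∫ y, fderiv ℝ f y v ∂μ = 0 := by
  have h1 : Integrable (fun y => fderiv ℝ f y v) μ :=
    ((hf.continuous_fderiv (by simp)).clm_apply continuous_const).integrable_of_hasCompactSupport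
      (hs.fderiv_apply (𝕜 := ℝ) v)
  have h2 : Integrable f μ := hf.continuous.integrable_of_hasCompactSupport hs
  have h3 := integral_mul_fderiv_eq_neg_fderiv_mul_of_integrable (μ := μ)
    (f := fun _ : E => (1 : ℝ)) (g := f) (v := v) (by simp) (by simpa using h1) (by simpa using h2) (fun _ _ => by fun_prop)
    (fun y _ => hf.contDiffAt.differentiableAt (by simp))
  simpa using h3

theorem integral_extDeriv_apply_eq_zero {β : E → E [⋀^Fin m]→L[ℝ] ℝ} (hβ : ContDiff ℝ ∞ β)
    (hs : HasCompactSupport β) (v : Fin (m + 1) → E) : ∫ y, extDeriv β y v ∂μ = 0 := by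
  have hc (w : Fin m → E) : ContDiff ℝ ∞ fun y => β y w :=
    contDiff_iff_contDiffAt.2 fun y => hβ.contDiffAt.alternatingMap_apply w
  have hcs (w : Fin m → E) : HasCompactSupport fun y => β y w :=
    hs.mono fun y hy hy' => hy (by simp [hy'])
  have h1 (y : E) : extDeriv β y v =
      ∑ i, (-1 : ℝ) ^ i.val • fderiv ℝ (fun z => β z (i.removeNth v)) y (v i) := by
    rw [extDeriv_apply (hβ.contDiffAt.differentiableAt (by simp))]
    exact Finset.sum_congr rfl fun i _ => by simp [zsmul_eq_mul]
  simp only [h1]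
  rw [integral_finsetSum]
  · refine Finset.sum_eq_zero fun i _ => ?_
    rw [integral_smul, integral_fderiv_apply_eq_zero μ (hc _) (hcs _), smul_zero]
  · intro i _
    refine Integrable.smul ((-1 : ℝ) ^ i.val) ?_
    exact (((hc _).continuous_fderiv (by simp)).clm_apply
      continuous_const).integrable_of_hasCompactSupport ((hcs _).fderiv_apply (𝕜 := ℝ) _)

/-- The change of variables formula for forms of top degree on a complex manifold. -/
theorem chartIntegral_eq_chartIntegral {l : ℕ} (b : Module.Basis (Fin l) ℝ E)
    {φ φ' : OpenPartialHomeomorph M E} (hφ : φ ∈ atlas E M) (hφ' : φ' ∈ atlas E M)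
    {α : DForm E M l ℝ} (h0 : ∀ x, α x ≠ 0 → x ∈ φ.source ∧ x ∈ φ'.source) :
    chartIntegral μ b φ α = chartIntegral μ b φ' α := by
  set τ := φ.symm.trans φ'
  have h1 : chartIntegral μ b φ α = ∫ y in τ.source, α.inChart φ y b ∂μ := by
    refine setIntegral_eq_of_subset_of_forall_sdiff_eq_zero φ.open_target.measurableSet ?_ ?_
    · exact fun y hy => ((φ.symm.trans_source φ').subset hy).1
    · intro y hy
      rw [inChart_eq_zero]
      · rfl
      · by_contra hne
        exact hy.2 ((φ.symm.trans_source φ').symm.subset ⟨hy.1, (h0 _ hne).2⟩)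
  have h2 : chartIntegral μ b φ' α = ∫ y in τ.target, α.inChart φ' y b ∂μ := by
    refine setIntegral_eq_of_subset_of_forall_sdiff_eq_zero φ'.open_target.measurableSet ?_ ?_
    · exact fun y hy => ((φ.symm.trans_target φ').subset hy).1
    · intro y hy
      rw [inChart_eq_zero]
      · rfl
      · by_contra hne
        exact hy.2 ((φ.symm.trans_target φ').symm.subset ⟨hy.1, (h0 _ hne).1⟩)
  have hτ (y : E) (hy : y ∈ τ.source) : ContDiffAt ℂ ω (φ' ∘ φ.symm) y :=
    contDiffAt_chart_comp hφ' (contMDiffAt_chart_symm hφ hy.1) hy.2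
  rw [h1, h2, ← τ.image_source_eq_target,
    integral_image_eq_integral_abs_det_fderiv_smul μ τ.open_source.measurableSet
      (f' := fun y => fderiv ℝ (φ' ∘ φ.symm) y) (fun y hy => ?_) τ.injOn]
  · refine setIntegral_congr_fun τ.open_source.measurableSet fun y hy => ?_
    have h3 := pullback_eq_inChart hφ' α (contMDiffAt_chart_symm hφ hy.1) hy.2
    have h4 := fderiv_real_eq_restrictScalars (hτ y hy)
    have h5 : (fderiv ℝ (φ' ∘ φ.symm) y).det =
        Complex.normSq (LinearMap.det (fderiv ℂ (φ' ∘ φ.symm) y).toLinearMap) := by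
      rw [h4, ← Algebra.norm_complex_apply, ← LinearMap.det_restrictScalars]
      rfl
    rw [h5, abs_of_nonneg (Complex.normSq_nonneg _), DForm.inChart, h3, h4, smul_eq_mul]
    exact map_comp_complexLinear (α.inChart φ' (φ' (φ.symm y))) b
      (fderiv ℂ (φ' ∘ φ.symm) y).toLinearMap
  · exact ((hτ y hy).restrict_scalars ℝ |>.differentiableAt (by simp)).hasFDerivAt.hasFDerivWithinAt

/-- Stokes' theorem for a form with support in the domain of a chart. -/
theorem chartIntegral_d_eq_zero [CompactSpace M] [T2Space M] {φ : OpenPartialHomeomorph M E}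
    (hφ : φ ∈ atlas E M) {α : DForm E M m ℝ} (hα : α.IsSmooth) {K : Set M} (hK : IsClosed K)
    (hKφ : K ⊆ φ.source) (h0 : ∀ x ∉ K, α x = 0) (v : Fin (m + 1) → E) :
    chartIntegral μ v φ α.d = 0 := by
  classical
  -- The expression of the form in the chart, extended by zero to the whole model space.
  set β : E → E [⋀^Fin m]→L[ℝ] ℝ := φ.target.indicator (α.inChart φ)
  have hC : IsCompact (φ '' K) := hK.isCompact.image_of_continuousOn (φ.continuousOn.mono hKφ)
  have hC' : φ '' K ⊆ φ.target := by
    rintro _ ⟨x, hx, rfl⟩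
    exact φ.map_source (hKφ hx)
  have hβ0 (y : E) (hy : y ∉ φ '' K) : β y = 0 := by
    by_cases hyt : y ∈ φ.target
    · refine (Set.indicator_of_mem hyt _).trans ?_
      exact inChart_eq_zero (h0 _ fun h => hy ⟨_, h, φ.right_inv hyt⟩)
    · exact Set.indicator_of_notMem hyt _
  have hβα (y : E) (hy : y ∈ φ.target) : β =ᶠ[𝓝 y] α.inChart φ := by
    filter_upwards [φ.open_target.mem_nhds hy] with z hz
    exact Set.indicator_of_mem hz _
  have hβ : ContDiff ℝ ∞ β := by
    refine contDiff_iff_contDiffAt.2 fun y => ?_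
    by_cases hy : y ∈ φ.target
    · exact (isSmooth_iff_contDiffAt.1 hα φ hφ y hy).congr_of_eventuallyEq (hβα y hy)
    · have h1 : β =ᶠ[𝓝 y] fun _ => 0 := by
        filter_upwards [hC.isClosed.isOpen_compl.mem_nhds fun h => hy (hC' h)] with z hz
        exact hβ0 z hz
      exact contDiffAt_const.congr_of_eventuallyEq h1
  have hs : HasCompactSupport β := HasCompactSupport.intro hC hβ0
  have h1 : chartIntegral μ v φ α.d = ∫ y in φ.target, extDeriv β y v ∂μ := by
    refine setIntegral_congr_fun φ.open_target.measurableSet fun y hy => ?_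
    rw [DForm.d, viaChart_inChart isNaturalOperator_extDeriv hα hφ hy, (hβα y hy).extDeriv_eq]
  rw [h1, setIntegral_eq_integral_of_forall_compl_eq_zero, integral_extDeriv_apply_eq_zero μ hβ hs]
  intro y hy
  have h2 : β =ᶠ[𝓝 y] fun _ => 0 := by
    filter_upwards [hC.isClosed.isOpen_compl.mem_nhds fun h => hy (hC' h)] with z hz
    exact hβ0 z hz
  rw [h2.extDeriv_eq, extDeriv, fderiv_fun_const]
  exact congrArg (fun K : E [⋀^Fin (m + 1)]→L[ℝ] ℝ => K v)
    (map_zero (ContinuousAlternatingMap.alternatizeUncurryFinCLM ℝ E ℝ))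

end Integral

/-- On a compact complex manifold an exact form of top degree cannot be nonnegative without being
zero: its integral vanishes by Stokes' theorem, complex charts being compatible with the
orientation. -/
theorem DForm.IsSmooth.d_eq_zero_of_nonneg [CompactSpace M] [T2Space M]
    (b : Module.Basis (Fin (m + 1)) ℝ E) {η : DForm E M m ℝ} (hη : η.IsSmooth)
    (h : ∀ x, 0 ≤ η.d x b) : η.d = 0 := by
  borelize E
  let μ : Measure E := Measure.addHaar
  obtain ⟨t, ht⟩ := isCompact_univ.elim_finite_subcover (fun x : M => (chartAt E x).source)
    (fun x => (chartAt E x).open_source) fun x _ => Set.mem_iUnion.2 ⟨x, mem_chart_source E x⟩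
  have : IsManifold 𝓘(ℝ, E) ∞ M := IsManifold.of_le (n := ω) le_top
  obtain ⟨χ, hχ⟩ := SmoothPartitionOfUnity.exists_isSubordinate 𝓘(ℝ, E) isClosed_univ
    (fun i : t => (chartAt E (i : M)).source) (fun i => (chartAt E (i : M)).open_source)
    (fun x hx => by simpa using ht hx)
  have hsum (x : M) : ∑ i, χ i x = 1 := by
    rw [← finsum_eq_sum_of_fintype]
    exact χ.sum_eq_one (Set.mem_univ x)
  have hat (i : t) := chart_mem_atlas E (i : M)
  let ηi (i : t) : DForm E M m ℝ := fun x => χ i x • η x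
  have hηi (i : t) : (ηi i).IsSmooth := hη.smul (χ i).contMDiff
  have hηi0 (i : t) (x : M) (hx : x ∉ tsupport (χ i)) : ηi i x = 0 := by
    simp only [ηi, image_eq_zero_of_notMem_tsupport hx, zero_smul]
  have hdηi (i : t) : (ηi i).d.IsSmooth := (hηi i).viaChart isNaturalOperator_extDeriv
  have hdηi0 (i : t) (x : M) (hx : x ∉ tsupport (χ i)) : (ηi i).d x = 0 :=
    d_eq_zero_of_eventually_eq_zero <|
      ((isClosed_tsupport _).isOpen_compl.mem_nhds hx : _ ∈ 𝓝 x) |> fun h =>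
        Filter.mem_of_superset h fun z hz => hηi0 i z hz
  -- The integrals of `χ j • d(χ i • η)` in the charts `i` and `j` agree. Summing over `j` in the
  -- chart `i` gives zero, and summing over `i` in the chart `j` gives the integral of `χ j • dη`.
  let Ω (i j : t) : DForm E M (m + 1) ℝ := fun x => χ j x • (ηi i).d x
  have hΩ (i j : t) : (Ω i j).IsSmooth := (hdηi i).smul (χ j).contMDiff
  have hΩ0 (i j : t) (x : M) (hx : Ω i j x ≠ 0) : x ∈ tsupport (χ i) ∧ x ∈ tsupport (χ j) := by
    constructor
    · by_contra h
      exact hx (by simp only [Ω, hdηi0 i x h, smul_zero])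
    · by_contra h
      exact hx (by simp only [Ω, image_eq_zero_of_notMem_tsupport h, zero_smul])
  have hcpt (i : t) : IsCompact (tsupport (χ i)) := (isClosed_tsupport _).isCompact
  have hrow (i : t) : ∑ j, chartIntegral μ b (chartAt E (i : M)) (Ω i j) = 0 := by
    rw [← chartIntegral_sum, ← chartIntegral_d_eq_zero μ (hat i) (hηi i) (isClosed_tsupport _)
      (hχ i) (hηi0 i) b]
    · congr 1
      ext1 x
      simp only [Ω]
      rw [← Finset.sum_smul, hsum, one_smul]
    · exact fun j => integrableOn_inChart μ (hΩ i j) (hat i) (hcpt i) (hχ i)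
        (fun x hx => by_contra fun h => hx (hΩ0 i j x h).1) b
  have hcol (j : t) : ∑ i, chartIntegral μ b (chartAt E (j : M)) (Ω i j) =
      chartIntegral μ b (chartAt E (j : M)) fun x => χ j x • η.d x := by
    rw [← chartIntegral_sum]
    · congr 1
      ext1 x
      simp only [Ω]
      rw [← Finset.smul_sum, ← d_sum hηi]
      congr 3
      ext1 x
      simp only [ηi]
      rw [← Finset.sum_smul, hsum, one_smul]
    · exact fun i => integrableOn_inChart μ (hΩ i j) (hat j) (hcpt j) (hχ j)
        (fun x hx => by_contra fun h => hx (hΩ0 i j x h).2) b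
  have hdη : η.d.IsSmooth := hη.viaChart isNaturalOperator_extDeriv
  let Θ (j : t) : DForm E M (m + 1) ℝ := fun x => χ j x • η.d x
  have hΘ (j : t) : (Θ j).IsSmooth := hdη.smul (χ j).contMDiff
  have hΘ0 (j : t) (y : E) (hy : y ∈ (chartAt E (j : M)).target) :
      0 ≤ (Θ j).inChart (chartAt E (j : M)) y b :=
    inChart_nonneg b (hat j) hy (mul_nonneg (χ.nonneg j _) (h _))
  have htotal : ∑ j : t, chartIntegral μ b (chartAt E (j : M)) (Θ j) = 0 := by
    rw [← Finset.sum_congr rfl fun j _ => hcol j, Finset.sum_comm]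
    refine Finset.sum_eq_zero fun i _ => ?_
    rw [← hrow i]
    refine Finset.sum_congr rfl fun j _ => ?_
    exact chartIntegral_eq_chartIntegral μ b (hat j) (hat i) fun x hx =>
      ⟨hχ j (hΩ0 i j x hx).2, hχ i (hΩ0 i j x hx).1⟩
  have hzero (j : t) : chartIntegral μ b (chartAt E (j : M)) (Θ j) = 0 :=
    (Finset.sum_eq_zero_iff_of_nonneg fun (j : t) _ => setIntegral_nonneg
      (chartAt E (j : M)).open_target.measurableSet fun y hy => hΘ0 j y hy).1 htotal j
      (Finset.mem_univ j)
  ext1 x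
  obtain ⟨j, hj⟩ : ∃ j, χ j x ≠ 0 := by
    by_contra! hne
    simpa [hne] using hsum x
  have hxj : x ∈ (chartAt E (j : M)).source := hχ j (subset_tsupport _ hj)
  have hae := (setIntegral_eq_zero_iff_of_nonneg_ae
    ((ae_restrict_iff' (chartAt E (j : M)).open_target.measurableSet).2
      (Filter.Eventually.of_forall (hΘ0 j)))
    (integrableOn_inChart μ (hΘ j) (hat j) (hcpt j) (hχ j) (fun x hx => by
      simp only [Θ, image_eq_zero_of_notMem_tsupport hx, zero_smul]) b)).1 (hzero j)
  have hy := Measure.eqOn_open_of_ae_eq hae (chartAt E (j : M)).open_target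
    ((hΘ j).continuousOn_inChart_apply (hat j) b) continuousOn_const
    ((chartAt E (j : M)).map_source hxj)
  exact (smul_eq_zero.1 (eq_zero_of_inChart_eq_zero (hat j) hxj
    (ContinuousAlternatingMap.eq_zero_of_map_basis _ b hy))).resolve_left hj

end Stokes

/-! ### Gauduchon metrics and semi-positivity -/

section Main

variable {E : Type*} [NormedAddCommGroup E] [NormedSpace ℂ E]
variable {M : Type*} [TopologicalSpace M] [ChartedSpace E M] [IsManifold 𝓘(ℂ, E) ω M]

theorem DForm.d_const_smul {k : ℕ} (c : ℝ) (α : DForm E M k ℝ) (x : M) :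
    DForm.d (fun x => c • α x) x = c • α.d x := by
  simp only [DForm.d, viaChart_apply_eq]
  exact extDeriv_fun_smul c (α.inChart (chartAt E x))

variable {X : Type*} [TopologicalSpace X] [ChartedSpace E X] [IsManifold 𝓘(ℂ, E) ω X]
variable {g : HermitianMetric E M} {θ : DForm E M 1 ℝ} {π : X → M} {h : HermitianMetric E X}
  {ψ : X → ℝ}

/-- Since `ω₀ = ω - θ ∧ θ^c`, the form `ω₀` is always of type `(1,1)`, and it is semi-positive
exactly where `|θ|² ≤ 1`. -/
theorem IsPotentialCovering.isSemiPositive_omegaZero_iff (hπ : IsPotentialCovering g θ π h ψ) :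
    (omegaZero θ).IsSemiPositive ↔ ∀ (x : M) (v : E),
      θ x (fun _ => v) ^ 2 + θ x (fun _ => tangentI E v) ^ 2 ≤ g.bilin x v v := by
  have hneg (x : M) (v : E) : θ x (fun _ => -v) = -θ x (fun _ => v) :=
    map_neg ((ContinuousAlternatingMap.ofSubsingleton ℝ E ℝ (0 : Fin 1)).symm (θ x)) v
  have hI (x : M) (v w : E) : g.bilin x (tangentI E v) (tangentI E w) = g.bilin x v w :=
    g.inner_tangentI x v w
  have hdiag (x : M) (v : E) : omegaZero θ x ![tangentI E v, v] =
      g.bilin x v v - (θ x (fun _ => v) ^ 2 + θ x (fun _ => tangentI E v) ^ 2) := by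
    rw [hπ.omegaZero_apply, hI, tangentI_tangentI, hneg]
    ring
  refine ⟨fun hs x v => ?_, fun hs x v w => ⟨?_, ?_⟩⟩
  · have h1 := (hs x v v).2
    rw [hdiag] at h1
    linarith
  · rw [hπ.omegaZero_apply, hπ.omegaZero_apply, hI, tangentI_tangentI, tangentI_tangentI, hneg,
      hneg]
    ring
  · rw [hdiag]
    linarith [hs x v]

/-- Up to the sign `(-1)^N` and a constant that is positive if `N = n - 1 > 0`, the top form
`dd^c ω^N` takes on a suitable basis the value `s = 1 - |θ|²`, of which only the sign is
recorded. -/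
theorem IsPotentialCovering.exists_basis_d_dc_wedgePow [FiniteDimensional ℂ E]
    (hπ : IsPotentialCovering g θ π h ψ) {N : ℕ} (hdim : Module.finrank ℂ E = N + 1) (x : M) :
    ∃ (e : Module.Basis (Fin (N + 1)) ℂ E) (s : ℝ),
      ((∀ v, θ x (fun _ => v) ^ 2 + θ x (fun _ => tangentI E v) ^ 2 ≤ g.bilin x v v) ↔ 0 ≤ s) ∧
      (DForm.viaChart localDc fun x => wedgePow (g.form x) N).d x (realBasis e) =
        (-1) ^ N * (N * (N + 1).factorial * s) := by
  obtain ⟨e, s, h1, h2⟩ := exists_basis_altSum_eq hdim (g.bilin x) (g.metric.symm x)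
    (g.metric.pos x) (g.inner_tangentI x)
    ((ContinuousAlternatingMap.ofSubsingleton ℝ E ℝ (0 : Fin 1)).symm (θ x))
  refine ⟨e, s, h1, mul_left_cancel₀ (pow_ne_zero N (two_ne_zero' ℝ)) ?_⟩
  have h3 := hπ.two_pow_mul_d_dc_wedgePow x (realBasis e)
  rw [h3]
  refine (congrArg (fun t : ℝ => N * t) h2).trans ?_
  rw [neg_pow (2 : ℝ)]
  ring

theorem HermitianMetric.isGauduchon_iff [FiniteDimensional ℂ E] {N : ℕ}
    (hdim : Module.finrank ℂ E = N + 1) (hg : g.form.IsSmooth) :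
    g.IsGauduchon ↔ (DForm.viaChart localDc fun x => wedgePow (g.form x) N).d = 0 := by
  rw [← del_delBar_toComplex_eq_zero_iff (hg.wedgePow N)]
  have h1 : Module.finrank ℂ E - 1 = N := by omega
  subst h1
  rfl

end Main

theorem mainTheorem4 {E : Type*} [NormedAddCommGroup E] [NormedSpace ℂ E] [FiniteDimensional ℂ E]
    (hn : 2 ≤ Module.finrank ℂ E)
    {M : Type u} [TopologicalSpace M] [T2Space M] [CompactSpace M] [ConnectedSpace M]
    [ChartedSpace E M] [IsManifold 𝓘(ℂ, E) ω M]
    (g : HermitianMetric E M) (θ : DForm E M 1 ℝ) (hg : IsLCKWithPotential g θ) :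
    g.IsGauduchon ↔ (omegaZero θ).IsSemiPositive := by
  obtain ⟨-, X, _, _, _, _, _, π, h, ψ, hπ⟩ := hg
  obtain ⟨N, hdim⟩ : ∃ N, Module.finrank ℂ E = N + 1 := ⟨Module.finrank ℂ E - 1, by omega⟩
  have hN : (0 : ℝ) < N * (N + 1).factorial := by
    have h1 : 0 < N := by omega
    positivity
  rw [HermitianMetric.isGauduchon_iff hdim hπ.isSmooth_form, hπ.isSemiPositive_omegaZero_iff]
  constructor
  · intro h0 x
    obtain ⟨e, s, h1, h2⟩ := hπ.exists_basis_d_dc_wedgePow hdim x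
    refine h1.2 (le_of_eq ?_)
    rw [h0] at h2
    have h3 : (-1 : ℝ) ^ N ≠ 0 := pow_ne_zero N (by norm_num)
    exact ((mul_eq_zero.1 ((mul_eq_zero.1 h2.symm).resolve_left h3)).resolve_left hN.ne').symm
  · intro hs
    -- The sign makes `dη` nonnegative on the real bases that underlie complex bases.
    let η : DForm E M (2 * N + 1) ℝ :=
      fun x => (-1 : ℝ) ^ N • DForm.viaChart localDc (fun x => wedgePow (g.form x) N) x
    have hη : η.IsSmooth := DForm.IsSmooth.smul (χ := fun _ => (-1 : ℝ) ^ N) contMDiff_const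
      ((hπ.isSmooth_form.wedgePow N).viaChart isNaturalOperator_localDc)
    have hηd := hη.d_eq_zero_of_nonneg (realBasis (Module.finBasisOfFinrankEq ℂ E hdim))
      fun x => by
        obtain ⟨e, s, h1, h2⟩ := hπ.exists_basis_d_dc_wedgePow hdim x
        obtain ⟨r, hr, h3⟩ := exists_pos_map_realBasis e (Module.finBasisOfFinrankEq ℂ E hdim)
        rw [h3, DForm.d_const_smul, ContinuousAlternatingMap.smul_apply, h2, smul_eq_mul,
          ← mul_assoc ((-1 : ℝ) ^ N), ← mul_pow]
        have h4 := h1.1 (hs x)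
        norm_num
        positivity
    ext1 x
    have h5 := congrFun hηd x
    rw [DForm.d_const_smul] at h5
    exact (smul_eq_zero.1 h5).resolve_left (pow_ne_zero N (by norm_num))
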